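/- Let $\Theta\subseteq\mathbb{R}^d$ and let $\{P_\theta\}_{\theta\in\Theta}$ be probability measures on a measurable space $\mathcal X$ with densities $f(x|\theta)$ with respect to a measure $\nu$. Let $S_\theta(x)=\big(\tfrac{\partial}{\partial\theta_i}\log f(x|\theta)\big)_{i=1}^d$ be the score (derivatives taken within $\Theta$) and $I_X(\theta)=\mathbb{E}_\theta[S_\theta(X)S_\theta(X)^T]$, $X\sim P_\theta$. Assume that for $\nu$-almost every $x$ the map $\theta\mapsto\sqrt{f(x|\theta)}$ is continuously differentiable on $\Theta$ in each coordinate, and that for all $\theta\in\Theta$ the matrix $I_X(\theta)$ exists, with entries that are continuous in each coordinate of $\theta$. Suppose $[-B,B]^d\subset\Theta$ for some $B>0$, and let $I_0\ge 0$. Let $X_1,\dots,X_n$ be i.i.d. with law $P_\theta$, node $i$ observing $X_i$, and let the nodes communicate with $k$ bits per node through a protocol of one of the following types. - Independent: node $i$ sends a random message $M_i\in[2^k]$, drawn from conditional probabilities $p_i(m|X_i)$. - Sequential: node $i$ sends $M_i\in[2^k]$, drawn from conditional probabilities $p_i(m|X_i;M_1,\dots,M_{i-1})$ that depend also on the earlier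 messages. - Blackboard: a complete binary tree of depth $nk$ is fixed; each internal vertex $v$ carries a label $l_v\in[n]$ and a measurable function $b_v:\mathcal X\to[0,1]$, and for every $i\in[n]$ each path from the root to a leaf visits exactly $k$ vertices labelled $i$. At vertex $v$, node $l_v$ writes the bit $1$ with probability $b_v(X_{l_v})$ and $0$ otherwise, and the protocol follows the corresponding edge. Let $\hat\theta$ be any $\mathbb{R}^d$-valued function of the messages $(M_1,\dots,M_n)$ (for a blackboard protocol, of the $nk$ bits written). 1. If $\mathsf{Var}_\theta(\langle u,S_\theta(X)\rangle)\le I_0$ for all $\theta\in\Theta$ and all unit vectors $u\in\mathbb{R}^d$, then $$\sup_{\theta\in\Theta}\mathbb{E}_\theta\|\hat\theta-\theta\|_2^2\ \ge\ \frac{d^2}{I_0\,2^k\,n+\frac{d\pi^2}{B^2}}.$$ 2. If for some $p\ge1$ one has $\|\langle u,S_\theta(X)\rangle\|_{\Psi_p}^2\le I_0$ for all $\theta\in\Theta$ and all unit vectors $u\in\mathbb{R}^d$, where $\|Z\|_{\Psi_p}=\inf\{K\in(0,\infty):\mathbb{E}_\theta[\exp((|Z|/K)^p)-1]\le1\}$,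 then $$\sup_{\theta\in\Theta}\mathbb{E}_\theta\|\hat\theta-\theta\|_2^2\ \ge\ \frac{d^2}{4I_0\,k^{2/p}\,n+\frac{d\pi^2}{B^2}}.$$ (For $d=0$ the right-hand sides are read as $0$.) -/

import Mathlib

open MeasureTheory ProbabilityTheory
open scoped ENNReal

noncomputable section

namespace QuantizedEstimation

/-! ### The statistical model -/

/-- `ℝ^d` with the Euclidean norm. -/
abbrev Param (d : ℕ) : Type := EuclideanSpace ℝ (Fin d)

variable {X : Type*} [MeasurableSpace X] {d : ℕ}

/-- The distribution `P_θ` with density `f(·|θ)` with respect to `ν`. -/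
def dist (ν : Measure X) (f : Param d → X → ℝ) (θ : Param d) : Measure X :=
  ν.withDensity fun x => ENNReal.ofReal (f θ x)

/-- The score `S_θ(x) = (∂/∂θ_1 log f(x|θ), …, ∂/∂θ_d log f(x|θ))`. The partial derivatives are
taken within `Θ`, so they are one-sided at points where `Θ` ends in a coordinate direction. -/
def score (Θ : Set (Param d)) (f : Param d → X → ℝ) (θ : Param d) (x : X) : Param d :=
  WithLp.toLp 2 fun i =>
    lineDerivWithin ℝ (fun η => Real.log (f η x)) Θ θ (EuclideanSpace.single i 1)

/-- The Fisher information matrix `I_X(θ) = E_θ[S_θ(X) S_θ(X)ᵀ]`. -/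
def fisherInfo (ν : Measure X) (Θ : Set (Param d)) (f : Param d → X → ℝ) (θ : Param d) :
    Matrix (Fin d) (Fin d) ℝ :=
  Matrix.of fun i j => ∫ x, score Θ f θ x i * score Θ f θ x j ∂(dist ν f θ)

/-- The line through `θ` parallel to the `i`-th coordinate axis. -/
def coordLine (θ : Param d) (i : Fin d) (t : ℝ) : Param d :=
  θ + t • EuclideanSpace.single i 1

/-- `f(·|θ)`, `θ ∈ Θ`, is a family of probability densities with respect to `ν` such that
`θ ↦ √f(x|θ)` is coordinate-wise continuously differentiable for `ν`-almost every `x`, and the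
Fisher information matrix exists and is coordinate-wise continuous. -/
structure IsRegularFamily (ν : Measure X) (Θ : Set (Param d)) (f : Param d → X → ℝ) : Prop where
  measurable : ∀ θ ∈ Θ, Measurable (f θ)
  nonneg : ∀ θ ∈ Θ, ∀ x, 0 ≤ f θ x
  isProbabilityMeasure : ∀ θ ∈ Θ, IsProbabilityMeasure (dist ν f θ)
  contDiff_sqrt : ∀ᵐ x ∂ν, ∀ θ ∈ Θ, ∀ i : Fin d,
    ContDiffOn ℝ 1 (fun t => √(f (coordLine θ i t) x)) {t | coordLine θ i t ∈ Θ}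
  integrable_fisherInfo : ∀ θ ∈ Θ, ∀ i j : Fin d,
    Integrable (fun x => score Θ f θ x i * score Θ f θ x j) (dist ν f θ)
  continuous_fisherInfo : ∀ θ ∈ Θ, ∀ i j l : Fin d,
    ContinuousOn (fun t => fisherInfo ν Θ f (coordLine θ l t) i j) {t | coordLine θ l t ∈ Θ}

/-- The Orlicz norm `‖Z‖_{Ψ_p} = inf {K ∈ (0,∞) | E[exp((|Z|/K)^p) - 1] ≤ 1}`, which is `∞` if
there is no such `K`. -/
def orliczNorm (p : ℝ) (Z : X → ℝ) (μ : Measure X) : ℝ≥0∞ :=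
  ⨅ (K : ℝ) (_ : 0 < K)
    (_ : ∫⁻ x, ENNReal.ofReal (Real.exp ((|Z x| / K) ^ p) - 1) ∂μ ≤ 1), ENNReal.ofReal K

/-! ### Communication protocols with `n` nodes and `k` bits per node -/

/-- A randomized `k`-bit quantization strategy, given by the conditional probabilities
`p(m|x)`. -/
structure Quantizer (X : Type*) [MeasurableSpace X] (k : ℕ) where
  prob : Fin (2 ^ k) → X → ℝ
  measurable : ∀ m, Measurable (prob m)
  nonneg : ∀ m x, 0 ≤ prob m x
  sum_eq_one : ∀ x, ∑ m, prob m x = 1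

/-- A blackboard protocol: a complete binary tree of depth `n * k`, whose internal nodes at level
`t` are the strings of the `t` bits written so far. Node `v` carries the label `l_v` of the
participant writing the next bit and the probability `b_v(x)` that this bit is `1`. On every path
from the root to a leaf each participant writes exactly `k` bits. -/
structure Blackboard (X : Type*) [MeasurableSpace X] (n k : ℕ) where
  label : (t : Fin (n * k)) → (Fin t → Bool) → Fin n
  bit : (t : Fin (n * k)) → (Fin t → Bool) → X → ℝ
  measurable : ∀ t v, Measurable (bit t v)
  mem_Icc : ∀ t v x, bit t v x ∈ Set.Icc (0 : ℝ) 1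
  card_label : ∀ (y : Fin (n * k) → Bool) (i : Fin n),
    (Finset.univ.filter fun t : Fin (n * k) =>
      label t (fun s => y (s.castLE t.isLt.le)) = i).card = k

/-- Independent, sequential and blackboard protocols. In a sequential protocol the quantizer of
node `i` depends on the messages of the nodes before `i`. -/
inductive Protocol (X : Type*) [MeasurableSpace X] (n k : ℕ) where
  | independent (q : Fin n → Quantizer X k)
  | sequential (q : (i : Fin n) → (Fin i → Fin (2 ^ k)) → Quantizer X k)
  | blackboard (b : Blackboard X n k)

variable {n k : ℕ}

/-- What the estimator sees: the messages `(M_1, …, M_n)`, or the `nk` bits on the blackboard. -/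
def Protocol.Transcript : Protocol X n k → Type
  | .independent _ => Fin n → Fin (2 ^ k)
  | .sequential _ => Fin n → Fin (2 ^ k)
  | .blackboard _ => Fin (n * k) → Bool

instance Protocol.fintypeTranscript : (c : Protocol X n k) → Fintype c.Transcript
  | .independent _ => inferInstanceAs (Fintype (Fin n → Fin (2 ^ k)))
  | .sequential _ => inferInstanceAs (Fintype (Fin n → Fin (2 ^ k)))
  | .blackboard _ => inferInstanceAs (Fintype (Fin (n * k) → Bool))

/-- The conditional probability of the transcript `y` given the samples `x_1, …, x_n`. -/
def Protocol.condProb : (c : Protocol X n k) → (Fin n → X) → c.Transcript → ℝ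
  | .independent q => fun x m => ∏ i, (q i).prob (m i) (x i)
  | .sequential q => fun x m =>
      ∏ i : Fin n, (q i fun j => m (j.castLE i.isLt.le)).prob (m i) (x i)
  | .blackboard b => fun x y =>
      ∏ t : Fin (n * k),
        let v : Fin t → Bool := fun s => y (s.castLE t.isLt.le)
        if y t then b.bit t v (x (b.label t v)) else 1 - b.bit t v (x (b.label t v))

/-- The probability of the transcript `y` when the samples are i.i.d. with law `P`. -/
def Protocol.prob (c : Protocol X n k) (P : Measure X) (y : c.Transcript) : ℝ :=
  ∫ x, c.condProb x y ∂(Measure.pi fun _ : Fin n => P)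

/-- The risk `E_θ ‖θ̂ - θ‖²` of an estimator computed from the transcript. -/
def risk (ν : Measure X) (f : Param d → X → ℝ) (c : Protocol X n k)
    (est : c.Transcript → Param d) (θ : Param d) : ℝ :=
  ∑ y, c.prob (dist ν f θ) y * ‖est y - θ‖ ^ 2

end QuantizedEstimation

end

/-! The bound is the van Trees inequality for the transcript. Under the product cosine-squared prior
on `[-b, b]^d`, the Bayes risk is at least `d²` divided by (trace of the transcript's Fisher
information, maximized over the cube, plus the prior's information `d π² / b²`); then `b` increases
to `B` (`van_trees`, `le_iSup_risk_of_node_information`). What remains is to bound that trace.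

For all three kinds of protocol the probability of a transcript given the samples is a product `∏
w_i(x_i)` (`Protocol.exists_isFactorization`). Hence its probability is `∏ q_i` with `q_i = E w_i`,
and its score is the sum of the conditional scores `E[w_i S] / q_i`. Cross terms have mean zero, so
the information is a sum over nodes (`sum_sq_sum_condScore_eq`). The budget of `k` bits enters
through `∑_y ∏_{j ≠ i} q_j = 2^k`, which holds because replacing what node `i` writes by uniform
bits yields a probability distribution again; it says that `E[1 / q_i] ≤ 2^k`.

Under the variance bound, Cauchy–Schwarz gives `‖E[w_i S]‖² ≤ q_i I₀`, so a node contributes at most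
`I₀ E[1 / q_i] ≤ I₀ 2^k`. Under the Orlicz bound, Jensen for `exp(z^p)` gives `‖E[w_i S] / q_i‖² ≤
I₀ (1 - log q_i)^(2/p)`. Since `(log z)²` is concave on `[e, ∞)`, the mean of `(1 - log q_i)²` is at
most `(1 + k log 2)² ≤ 4k²` for `k ≥ 1`, and a power mean inequality handles the exponent `2/p`.

The regularity hypotheses permit differentiating `∫ w f` for `0 ≤ w ≤ 1`: the derivative `f S w` is
dominated by `f + f S²`, which varies with the parameter but whose integral, one plus a Fisher
information entry, is continuous (`hasDerivAt_integral_of_continuousOn_bound`). -/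

namespace QuantizedEstimation

open Set Filter Topology

/-! ### Differentiation under the integral sign with a moving dominating function. -/

section DerivIntegral

variable {X : Type*} [MeasurableSpace X] {ν : Measure X}

/-- A countable union of sets of finite measure carries an s-finite restriction. -/
lemma sFinite_restrict_iUnion {T : ℕ → Set X} (hT : ∀ j, MeasurableSet (T j))
    (hfin : ∀ j, ν (T j) ≠ ∞) : SFinite (ν.restrict (⋃ j, T j)) := by
  rw [← iUnion_disjointed, Measure.restrict_iUnion (disjoint_disjointed _)
    (MeasurableSet.disjointed hT)]
  have : ∀ n, IsFiniteMeasure (ν.restrict (disjointed T n)) := fun n =>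
    ⟨by
      rw [Measure.restrict_apply_univ]
      exact (measure_mono (disjointed_subset T n)).trans_lt (hfin n).lt_top⟩
  infer_instance

/-- Countably many integrable functions vanish off a set on which the measure is s-finite. -/
lemma exists_sFinite_restrict_of_integrable {F : ℕ → X → ℝ} (hm : ∀ n, Measurable (F n))
    (hi : ∀ n, Integrable (F n) ν) :
    ∃ A, MeasurableSet A ∧ SFinite (ν.restrict A) ∧ ∀ x ∉ A, ∀ n, F n x = 0 := by
  -- The sets `{|F n| ≥ 1 / (m + 1)}`, enumerated through `Nat.unpair`; Markov's inequality makes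
  -- each of them finite in measure.
  let T : ℕ → Set X := fun j => {x | 1 / ((j.unpair.2 : ℝ) + 1) ≤ ‖F j.unpair.1 x‖}
  have hT : ∀ j, MeasurableSet (T j) := fun j =>
    measurableSet_le measurable_const (hm _).norm
  refine ⟨⋃ j, T j, MeasurableSet.iUnion hT, sFinite_restrict_iUnion hT fun j => ?_, ?_⟩
  · exact ((hi j.unpair.1).measure_norm_ge_lt_top (by positivity)).ne
  · intro x hx n
    by_contra h
    obtain ⟨m, hmn⟩ := exists_nat_one_div_lt (norm_pos_iff.2 h)
    refine hx (mem_iUnion.2 ⟨Nat.pair n m, ?_⟩)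
    simpa [T] using hmn.le

/-- Dominated convergence with dominating functions that vary, provided that their integrals
converge. -/
lemma tendsto_integral_of_tendsto_integral_bound {ι : Type*} {l : Filter ι}
    [l.IsCountablyGenerated] {F G : ι → X → ℝ} {F₀ G₀ : X → ℝ}
    (hFm : ∀ᶠ i in l, AEStronglyMeasurable (F i) ν) (hG : ∀ᶠ i in l, Integrable (G i) ν)
    (hG₀ : Integrable G₀ ν) (hb : ∀ᵐ x ∂ν, ∀ᶠ i in l, |F i x| ≤ G i x)
    (hb' : ∀ᶠ i in l, ∀ᵐ x ∂ν, |F i x| ≤ G i x)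
    (hF : ∀ᵐ x ∂ν, Tendsto (fun i => F i x) l (𝓝 (F₀ x)))
    (hGt : ∀ᵐ x ∂ν, Tendsto (fun i => G i x) l (𝓝 (G₀ x)))
    (hint : Tendsto (fun i => ∫ x, G i x ∂ν) l (𝓝 (∫ x, G₀ x ∂ν))) :
    Tendsto (fun i => ∫ x, F i x ∂ν) l (𝓝 (∫ x, F₀ x ∂ν)) := by
  rcases l.eq_or_neBot with rfl | hl
  · simp
  have hFG : ∀ᵐ x ∂ν, |F₀ x| ≤ G₀ x := by
    filter_upwards [hb, hF, hGt] with x h1 h2 h3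
    exact le_of_tendsto_of_tendsto h2.abs h3 h1
  -- `K` is `F` truncated to `[-M, M]` with `M = min G G₀`. It is dominated by the fixed function
  -- `G₀`, so ordinary dominated convergence applies, and the error `|F - K| ≤ G - M` has integral
  -- tending to zero.
  let M : ι → X → ℝ := fun i x => min (G i x) (G₀ x)
  let K : ι → X → ℝ := fun i x => max (-M i x) (min (F i x) (M i x))
  have hMm : ∀ᶠ i in l, AEStronglyMeasurable (M i) ν := by
    filter_upwards [hG] with i hi
    exact hi.1.inf hG₀.1
  have hKm : ∀ᶠ i in l, AEStronglyMeasurable (K i) ν := by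
    filter_upwards [hMm, hFm] with i hi hi'
    exact hi.neg.sup (hi'.inf hi)
  have hMb : ∀ᶠ i in l, ∀ᵐ x ∂ν, ‖M i x‖ ≤ G₀ x := by
    filter_upwards [hb'] with i hi
    filter_upwards [hi, hFG] with x h1 h2
    rw [Real.norm_eq_abs, abs_of_nonneg]
    · exact min_le_right _ _
    · exact le_min ((abs_nonneg _).trans h1) ((abs_nonneg _).trans h2)
  have hMl : Tendsto (fun i => ∫ x, M i x ∂ν) l (𝓝 (∫ x, G₀ x ∂ν)) := by
    refine tendsto_integral_filter_of_dominated_convergence G₀ hMm hMb hG₀ ?_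
    filter_upwards [hGt] with x hx
    simpa using hx.min (tendsto_const_nhds (x := G₀ x))
  have hKb : ∀ᶠ i in l, ∀ᵐ x ∂ν, ‖K i x‖ ≤ G₀ x := by
    filter_upwards [hb'] with i hi
    filter_upwards [hi, hFG] with x h1 h2
    have h0 : 0 ≤ M i x := le_min ((abs_nonneg _).trans h1) ((abs_nonneg _).trans h2)
    refine (abs_le.2 ⟨le_max_left _ _, max_le (by linarith) (min_le_right _ _)⟩ :
      |K i x| ≤ M i x).trans (min_le_right _ _)
  have hKl : Tendsto (fun i => ∫ x, K i x ∂ν) l (𝓝 (∫ x, F₀ x ∂ν)) := by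
    refine tendsto_integral_filter_of_dominated_convergence G₀ hKm hKb hG₀ ?_
    filter_upwards [hGt, hF, hFG] with x hx hx' hx2
    have h1 : Tendsto (fun i => M i x) l (𝓝 (G₀ x)) := by
      simpa using hx.min (tendsto_const_nhds (x := G₀ x))
    have h2 := h1.neg.max (hx'.min h1)
    rwa [min_eq_left ((le_abs_self _).trans hx2), max_eq_right (abs_le.1 hx2).1] at h2
  have hMi : ∀ᶠ i in l, Integrable (M i) ν := by
    filter_upwards [hMm, hMb] with i h1 h2 using hG₀.mono' h1 h2
  have hdiff : Tendsto (fun i => ∫ x, F i x ∂ν - ∫ x, K i x ∂ν) l (𝓝 0) := by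
    have h0 := hint.sub hMl
    rw [sub_self] at h0
    refine squeeze_zero_norm' ?_ h0
    filter_upwards [hFm, hKm, hKb, hG, hMi, hb'] with i h1 h2 h3 h4 h5 h6
    rw [← integral_sub (h4.mono' h1 h6) (hG₀.mono' h2 h3), ← integral_sub h4 h5]
    refine norm_integral_le_of_norm_le (h4.sub h5) ?_
    filter_upwards [h6, hFG] with x h7 h8
    have h0 : 0 ≤ M i x := le_min ((abs_nonneg _).trans h7) ((abs_nonneg _).trans h8)
    have h9 : M i x ≤ G i x := min_le_left _ _
    obtain ⟨h10, h11⟩ := abs_le.1 h7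
    rw [Real.norm_eq_abs, abs_le]
    simp only [K]
    rcases max_cases (-M i x) (min (F i x) (M i x)) with ⟨e, _⟩ | ⟨e, _⟩ <;>
      rcases min_cases (F i x) (M i x) with ⟨e', _⟩ | ⟨e', _⟩ <;>
      constructor <;> linarith
  simpa using hdiff.add hKl

/-- Difference quotients along a null sequence converge to the derivative. -/
lemma tendsto_seq_slope {φ : ℝ → ℝ} {φ' s : ℝ} (h : HasDerivAt φ φ' s) {ε : ℕ → ℝ}
    (hε : Tendsto ε atTop (𝓝 0)) (hε' : ∀ n, ε n ≠ 0) :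
    Tendsto (fun n => (ε n)⁻¹ * (φ (s + ε n) - φ s)) atTop (𝓝 φ') := by
  have := h.tendsto_slope_zero.comp
    (tendsto_nhdsWithin_iff.2 ⟨hε, Eventually.of_forall fun n => hε' n⟩)
  simpa using! this

lemma tendsto_const_div_add_atTop (δ : ℝ) (m : ℕ) :
    Tendsto (fun n : ℕ => δ / ((n : ℝ) + m)) atTop (𝓝 0) :=
  tendsto_const_nhds.div_atTop
    (tendsto_atTop_add_const_right _ _ tendsto_natCast_atTop_atTop)

variable {a b : ℝ} {F F' H : ℝ → X → ℝ}

lemma aestronglyMeasurable_of_hasDerivAt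
    (hFm : ∀ s ∈ Ioo a b, Measurable (F s))
    (hFd : ∀ᵐ x ∂ν, ∀ s ∈ Ioo a b, HasDerivAt (F · x) (F' s x) s)
    {s : ℝ} (hs : s ∈ Ioo a b) : AEStronglyMeasurable (F' s) ν := by
  have hbs : 0 < b - s := sub_pos.2 hs.2
  -- Starting the denominators at `2` makes `ε n < b - s` strict, so that `s + ε n` stays in the
  -- open interval.
  let ε : ℕ → ℝ := fun n => (b - s) / ((n : ℝ) + (2 : ℕ))
  have hε0 : ∀ n, 0 < ε n := fun n => by positivity
  have hε1 : ∀ n, ε n < b - s := fun n =>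
    div_lt_self hbs (by push_cast; linarith [n.cast_nonneg (α := ℝ)])
  refine (aemeasurable_of_tendsto_metrizable_ae' (μ := ν)
    (f := fun n x => (ε n)⁻¹ * (F (s + ε n) x - F s x)) (fun n => ?_) ?_).aestronglyMeasurable
  · have h1 : s + ε n ∈ Ioo a b := ⟨by linarith [hs.1, hε0 n], by linarith [hε1 n]⟩
    exact (((hFm _ h1).sub (hFm _ hs)).const_mul _).aemeasurable
  · filter_upwards [hFd] with x hx
    exact tendsto_seq_slope (hx s hs) (tendsto_const_div_add_atTop _ _) fun n => (hε0 n).ne'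

lemma continuousOn_integral_of_continuousOn_integral_bound
    (hF'm : ∀ s ∈ Ioo a b, AEStronglyMeasurable (F' s) ν)
    (hF'c : ∀ᵐ x ∂ν, ContinuousOn (F' · x) (Ioo a b))
    (hbd : ∀ᵐ x ∂ν, ∀ s ∈ Ioo a b, |F' s x| ≤ H s x)
    (hHc : ∀ᵐ x ∂ν, ContinuousOn (H · x) (Ioo a b))
    (hHi : ∀ s ∈ Ioo a b, Integrable (H s) ν)
    (hHint : ContinuousOn (fun s => ∫ x, H s x ∂ν) (Ioo a b)) :
    ContinuousOn (fun s => ∫ x, F' s x ∂ν) (Ioo a b) := by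
  intro s hs
  have hmem : ∀ᶠ r in 𝓝[Ioo a b] s, r ∈ Ioo a b := eventually_mem_nhdsWithin
  refine tendsto_integral_of_tendsto_integral_bound (G := H) (G₀ := H s)
    (hmem.mono fun r hr => hF'm r hr) (hmem.mono fun r hr => hHi r hr) (hHi s hs) ?_ ?_ ?_ ?_
    (hHint s hs)
  · filter_upwards [hbd] with x hx using hmem.mono fun r hr => hx r hr
  · filter_upwards [hmem] with r hr
    filter_upwards [hbd] with x hx using hx r hr
  · filter_upwards [hF'c] with x hx using hx s hs
  · filter_upwards [hHc] with x hx using hx s hs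

/-- Joint measurability of the derivative in the parameter. -/
lemma aestronglyMeasurable_uncurry_of_hasDerivAt [SFinite ν]
    (hFm : ∀ s ∈ Ioo a b, Measurable (F s))
    (hFd : ∀ᵐ x ∂ν, ∀ s ∈ Ioo a b, HasDerivAt (F · x) (F' s x) s)
    {s₁ s₂ : ℝ} (hs₁ : a < s₁) (hs : s₁ ≤ s₂) (hs₂ : s₂ < b) :
    AEStronglyMeasurable (Function.uncurry F') ((volume.restrict (Ioc s₁ s₂)).prod ν) := by
  obtain ⟨s₃, h23, h3b⟩ := exists_between hs₂
  obtain ⟨G, hGs, hGm, hG0⟩ := exists_measurable_superset_of_null hFd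
  -- Clamping the parameter to `[s₁, s₃]` and discarding the null set `G` gives a function on all of
  -- `ℝ × X` that is continuous in the parameter and measurable in `x`, hence jointly measurable.
  -- The gap between `s₂` and `s₃` is room for forward difference quotients.
  let cl : ℝ → ℝ := fun r => max s₁ (min r s₃)
  have hcl : Continuous cl := by fun_prop
  have hclm : ∀ r, cl r ∈ Ioo a b := fun r =>
    ⟨hs₁.trans_le (le_max_left _ _), max_lt (by linarith) ((min_le_right _ _).trans_lt h3b)⟩
  have hGd : ∀ x ∈ Gᶜ, ∀ s ∈ Ioo a b, HasDerivAt (F · x) (F' s x) s := fun x hx => by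
    by_contra h
    exact hx (hGs h)
  let Fb : ℝ → X → ℝ := fun r => Gᶜ.indicator (F (cl r))
  have hFb : Measurable (Function.uncurry Fb) := by
    refine measurable_uncurry_of_continuous_of_measurable (fun x => ?_)
      fun r => (hFm _ (hclm r)).indicator hGm.compl
    by_cases hx : x ∈ Gᶜ
    · have : ContinuousOn (F · x) (Ioo a b) := fun s hs =>
        (hGd x hx s hs).continuousAt.continuousWithinAt
      simpa [Fb, hx] using! this.comp_continuous hcl hclm
    · simpa [Fb, hx] using! continuous_const
  have hδ : 0 < s₃ - s₂ := sub_pos.2 h23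
  let ε : ℕ → ℝ := fun n => (s₃ - s₂) / ((n : ℝ) + (1 : ℕ))
  have hε0 : ∀ n, 0 < ε n := fun n => by positivity
  have hε1 : ∀ n, ε n ≤ s₃ - s₂ := fun n => div_le_self hδ.le (by simp)
  refine (aemeasurable_of_tendsto_metrizable_ae'
    (f := fun n (z : ℝ × X) => (ε n)⁻¹ * (Function.uncurry Fb (z.1 + ε n, z.2) -
      Function.uncurry Fb (z.1, z.2))) (fun n => ?_) ?_).aestronglyMeasurable
  · refine Measurable.aemeasurable ?_
    refine ((hFb.comp ?_).sub (hFb.comp ?_)).const_mul _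
    · exact (measurable_fst.add_const _).prodMk measurable_snd
    · exact measurable_fst.prodMk measurable_snd
  · have h1 : ∀ᵐ z ∂(volume.restrict (Ioc s₁ s₂)).prod ν, z.1 ∈ Ioc s₁ s₂ :=
      Measure.quasiMeasurePreserving_fst.ae (ae_restrict_mem measurableSet_Ioc)
    have h2 : ∀ᵐ z ∂(volume.restrict (Ioc s₁ s₂)).prod ν, z.2 ∈ Gᶜ :=
      Measure.quasiMeasurePreserving_snd.ae (p := fun x => x ∈ Gᶜ) (by
        simpa [ae_iff] using hG0)
    filter_upwards [h1, h2] with z hz1 hz2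
    have hzm : z.1 ∈ Ioo a b := ⟨hs₁.trans hz1.1, hz1.2.trans_lt hs₂⟩
    have := tendsto_seq_slope (hGd z.2 hz2 z.1 hzm) (tendsto_const_div_add_atTop (s₃ - s₂) 1)
      fun n => (hε0 n).ne'
    refine this.congr fun n => ?_
    have e1 : cl (z.1 + ε n) = z.1 + ε n := by
      simp only [cl]
      rw [min_eq_left (by linarith [hz1.2, hε1 n]), max_eq_right (by linarith [hz1.1, hε0 n])]
    have e2 : cl z.1 = z.1 := by
      simp only [cl]
      rw [min_eq_left (by linarith [hz1.2]), max_eq_right (by linarith [hz1.1])]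
    simp only [Function.uncurry, Fb, e1, e2, indicator_of_mem hz2]
    rfl

/-- The fundamental theorem of calculus under the integral sign, for an s-finite measure. -/
lemma integral_sub_eq_intervalIntegral_of_sFinite [SFinite ν]
    (hFm : ∀ s ∈ Ioo a b, Measurable (F s)) (hFi : ∀ s ∈ Ioo a b, Integrable (F s) ν)
    (hFd : ∀ᵐ x ∂ν, ∀ s ∈ Ioo a b, HasDerivAt (F · x) (F' s x) s)
    (hF'c : ∀ᵐ x ∂ν, ContinuousOn (F' · x) (Ioo a b))
    (hF'i : ∀ s ∈ Ioo a b, Integrable (F' s) ν)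
    {s₁ s₂ C : ℝ} (hs₁ : a < s₁) (hs : s₁ ≤ s₂) (hs₂ : s₂ < b)
    (hC : ∀ s ∈ Icc s₁ s₂, ∫ x, |F' s x| ∂ν ≤ C) :
    ∫ x, F s₂ x ∂ν - ∫ x, F s₁ x ∂ν = ∫ r in s₁..s₂, ∫ x, F' r x ∂ν := by
  have hsub : Icc s₁ s₂ ⊆ Ioo a b := fun r hr => ⟨hs₁.trans_le hr.1, hr.2.trans_lt hs₂⟩
  have hm := aestronglyMeasurable_uncurry_of_hasDerivAt hFm hFd hs₁ hs hs₂
  have hint : Integrable (Function.uncurry F') ((volume.restrict (Ioc s₁ s₂)).prod ν) := by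
    rw [integrable_prod_iff hm]
    constructor
    · filter_upwards [ae_restrict_mem measurableSet_Ioc] with r hr
      exact hF'i r (hsub (Ioc_subset_Icc_self hr))
    · refine Integrable.mono' (integrable_const C) hm.norm.integral_prod_right' ?_
      filter_upwards [ae_restrict_mem measurableSet_Ioc] with r hr
      rw [Real.norm_of_nonneg (integral_nonneg fun _ => norm_nonneg _)]
      exact hC r (Ioc_subset_Icc_self hr)
  rw [intervalIntegral.integral_of_le hs, integral_integral_swap hint,
    ← integral_sub (hFi _ (hsub (right_mem_Icc.2 hs))) (hFi _ (hsub (left_mem_Icc.2 hs)))]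
  refine integral_congr_ae ?_
  filter_upwards [hFd, hF'c] with x h1 h2
  rw [← intervalIntegral.integral_of_le hs]
  refine (intervalIntegral.integral_eq_sub_of_hasDerivAt (f := (F · x))
    (fun r hr => h1 r ?_) ?_).symm
  · rw [uIcc_of_le hs] at hr
    exact hsub hr
  · refine ContinuousOn.intervalIntegrable ?_
    rw [uIcc_of_le hs]
    exact h2.mono hsub

/-- Differentiation under the integral sign with a dominating function that depends continuously
on the parameter and has a continuous integral. -/
theorem hasDerivAt_integral_of_continuousOn_bound
    (hFm : ∀ s ∈ Ioo a b, Measurable (F s)) (hFi : ∀ s ∈ Ioo a b, Integrable (F s) ν)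
    (hFd : ∀ᵐ x ∂ν, ∀ s ∈ Ioo a b, HasDerivAt (F · x) (F' s x) s)
    (hF'c : ∀ᵐ x ∂ν, ContinuousOn (F' · x) (Ioo a b))
    (hbd : ∀ᵐ x ∂ν, ∀ s ∈ Ioo a b, |F' s x| ≤ H s x)
    (hHc : ∀ᵐ x ∂ν, ContinuousOn (H · x) (Ioo a b))
    (hHi : ∀ s ∈ Ioo a b, Integrable (H s) ν)
    (hHint : ContinuousOn (fun s => ∫ x, H s x ∂ν) (Ioo a b))
    {t : ℝ} (ht : t ∈ Ioo a b) :
    HasDerivAt (fun s => ∫ x, F s x ∂ν) (∫ x, F' t x ∂ν) t := by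
  classical
  have hF'm : ∀ s ∈ Ioo a b, AEStronglyMeasurable (F' s) ν := fun s hs =>
    aestronglyMeasurable_of_hasDerivAt hFm hFd hs
  have hF'i : ∀ s ∈ Ioo a b, Integrable (F' s) ν := fun s hs =>
    (hHi s hs).mono' (hF'm s hs) (hbd.mono fun x hx => hx s hs)
  have hcont := continuousOn_integral_of_continuousOn_integral_bound hF'm hF'c hbd hHc hHi hHint
  -- Fubini needs an s-finite measure and `ν` is arbitrary. The slices at rational parameters vanish
  -- off a set `A` on which `ν` is s-finite; by continuity in the parameter, almost everywhere off
  -- `A` all slices vanish, and with them their derivatives.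
  obtain ⟨q, hq⟩ := exists_surjective_nat ℚ
  let S : ℕ → X → ℝ := fun n => if (q n : ℝ) ∈ Ioo a b then F (q n) else 0
  have hSm : ∀ n, Measurable (S n) := fun n => by
    simp only [S]
    split_ifs with h
    · exact hFm _ h
    · exact measurable_const
  have hSi : ∀ n, Integrable (S n) ν := fun n => by
    simp only [S]
    split_ifs with h
    · exact hFi _ h
    · exact integrable_zero _ _ _
  obtain ⟨A, hA, hAs, hA0⟩ := exists_sFinite_restrict_of_integrable hSm hSi
  have hF0 : ∀ᵐ x ∂ν, x ∉ A → ∀ s ∈ Ioo a b, F s x = 0 := by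
    filter_upwards [hFd] with x hx hxA s hs
    by_contra hne
    have hev : ∀ᶠ r in 𝓝 s, F r x ≠ 0 ∧ r ∈ Ioo a b :=
      ((hx s hs).continuousAt.eventually_ne hne).and (isOpen_Ioo.mem_nhds hs)
    obtain ⟨r, ⟨p, rfl⟩, hr1, hr2⟩ :=
      Rat.denseRange_cast.inter_nhds_nonempty hev
    obtain ⟨n, hn⟩ := hq p
    have := hA0 x hxA n
    simp only [S, hn, if_pos hr2] at this
    exact hr1 this
  have hF'0 : ∀ᵐ x ∂ν, x ∉ A → ∀ s ∈ Ioo a b, F' s x = 0 := by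
    filter_upwards [hFd, hF0] with x hx hx0 hxA s hs
    refine (hx s hs).unique ((hasDerivAt_const s (0 : ℝ)).congr_of_eventuallyEq ?_)
    filter_upwards [isOpen_Ioo.mem_nhds hs] with r hr using hx0 hxA r hr
  have hFA : ∀ s ∈ Ioo a b, ∫ x in A, F s x ∂ν = ∫ x, F s x ∂ν := fun s hs =>
    setIntegral_eq_integral_of_ae_compl_eq_zero (hF0.mono fun x hx hxA => hx hxA s hs)
  have hF'A : ∀ s ∈ Ioo a b, ∫ x in A, F' s x ∂ν = ∫ x, F' s x ∂ν := fun s hs =>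
    setIntegral_eq_integral_of_ae_compl_eq_zero (hF'0.mono fun x hx hxA => hx hxA s hs)
  obtain ⟨s₁, has₁, hs₁t⟩ := exists_between ht.1
  have hs₁ : s₁ ∈ Ioo a b := ⟨has₁, hs₁t.trans ht.2⟩
  -- The integral is a primitive of the continuous function `hcont`, so it can be differentiated by
  -- the fundamental theorem of calculus.
  have key : ∀ s ∈ Ioo s₁ b, ∫ x, F s x ∂ν =
      ∫ x, F s₁ x ∂ν + ∫ r in s₁..s, ∫ x, F' r x ∂ν := by
    intro s hs
    have hsub : Icc s₁ s ⊆ Ioo a b := fun r hr => ⟨has₁.trans_le hr.1, hr.2.trans_lt hs.2⟩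
    obtain ⟨C, hC⟩ := isCompact_Icc.exists_bound_of_continuousOn (hHint.mono hsub)
    have h := integral_sub_eq_intervalIntegral_of_sFinite (ν := ν.restrict A) (F := F) (F' := F')
      (a := a) (b := b) (C := C) hFm (fun s hs => (hFi s hs).restrict) (ae_restrict_of_ae hFd)
      (ae_restrict_of_ae hF'c) (fun s hs => (hF'i s hs).restrict) has₁ hs.1.le hs.2 ?_
    · rw [hFA s ⟨has₁.trans hs.1, hs.2⟩, hFA s₁ hs₁] at h
      rw [sub_eq_iff_eq_add'.1 h, add_right_inj]
      refine intervalIntegral.integral_congr fun r hr => ?_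
      rw [uIcc_of_le hs.1.le] at hr
      exact hF'A r (hsub hr)
    · intro r hr
      calc ∫ x in A, |F' r x| ∂ν ≤ ∫ x, |F' r x| ∂ν :=
            setIntegral_le_integral (hF'i r (hsub hr)).abs (ae_of_all _ fun x => abs_nonneg _)
        _ ≤ ∫ x, H r x ∂ν := integral_mono_ae (hF'i r (hsub hr)).abs (hHi r (hsub hr))
            (hbd.mono fun x hx => hx r (hsub hr))
        _ ≤ C := (le_abs_self _).trans (hC r hr)
  have hts₁ : t ∈ Ioo s₁ b := ⟨hs₁t, ht.2⟩
  have hd : HasDerivAt (fun s => ∫ x, F s₁ x ∂ν + ∫ r in s₁..s, ∫ x, F' r x ∂ν)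
      (∫ x, F' t x ∂ν) t := by
    refine HasDerivAt.const_add _ (intervalIntegral.integral_hasDerivAt_right ?_ ?_ ?_)
    · refine ContinuousOn.intervalIntegrable ?_
      rw [uIcc_of_le hs₁t.le]
      exact hcont.mono fun r hr => ⟨has₁.trans_le hr.1, hr.2.trans_lt ht.2⟩
    · exact hcont.stronglyMeasurableAtFilter isOpen_Ioo t ht
    · exact hcont.continuousAt (isOpen_Ioo.mem_nhds ht)
  refine hd.congr_of_eventuallyEq ?_
  filter_upwards [isOpen_Ioo.mem_nhds hts₁] with s hs using key s hs

end DerivIntegral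

end QuantizedEstimation

namespace QuantizedEstimation

open Set Filter Topology

/-! ### Regularity of the statistical model inside the open cube. -/

section Model

variable {X : Type*} [MeasurableSpace X] {d : ℕ} {ν : Measure X} {Θ : Set (Param d)}
  {f : Param d → X → ℝ} {B : ℝ}

/-- The open cube `(-B, B)^d`. -/
def openCube (d : ℕ) (B : ℝ) : Set (Param d) := {θ | ∀ i, θ i ∈ Ioo (-B) B}

lemma coordLine_apply (θ : Param d) (l : Fin d) (s : ℝ) (i : Fin d) :
    coordLine θ l s i = if i = l then θ i + s else θ i := by
  by_cases h : i = l <;> simp [coordLine, h]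

lemma coordLine_zero (θ : Param d) (l : Fin d) : coordLine θ l 0 = θ := by
  simp [coordLine]

lemma coordLine_coordLine (θ : Param d) (l : Fin d) (s r : ℝ) :
    coordLine (coordLine θ l s) l r = coordLine θ l (s + r) := by
  simp [coordLine, add_smul, add_assoc]

lemma coordLine_mem_openCube {θ : Param d} (hθ : θ ∈ openCube d B) {l : Fin d} {s : ℝ}
    (hs : s ∈ Ioo (-B - θ l) (B - θ l)) : coordLine θ l s ∈ openCube d B := by
  intro i
  rw [coordLine_apply]
  split_ifs with h
  · subst h
    exact ⟨by linarith [hs.1], by linarith [hs.2]⟩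
  · exact hθ i

lemma zero_mem_line {θ : Param d} (hθ : θ ∈ openCube d B) (l : Fin d) :
    (0 : ℝ) ∈ Ioo (-B - θ l) (B - θ l) :=
  ⟨by linarith [(hθ l).1], by linarith [(hθ l).2]⟩

lemma openCube_subset (hΘ : {θ : Param d | ∀ i, θ i ∈ Icc (-B) B} ⊆ Θ) : openCube d B ⊆ Θ :=
  fun _ hθ => hΘ fun i => Ioo_subset_Icc_self (hθ i)

lemma integral_dist (hf : IsRegularFamily ν Θ f) {θ : Param d} (hθ : θ ∈ Θ) (φ : X → ℝ) :
    ∫ x, φ x ∂(dist ν f θ) = ∫ x, f θ x * φ x ∂ν := by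
  rw [dist, integral_withDensity_eq_integral_toReal_smul (hf.measurable θ hθ).ennreal_ofReal
    (ae_of_all _ fun _ => ENNReal.ofReal_lt_top)]
  refine integral_congr_ae (ae_of_all _ fun x => ?_)
  simp [ENNReal.toReal_ofReal (hf.nonneg θ hθ x)]

lemma integrable_dist_iff (hf : IsRegularFamily ν Θ f) {θ : Param d} (hθ : θ ∈ Θ) (φ : X → ℝ) :
    Integrable φ (dist ν f θ) ↔ Integrable (fun x => f θ x * φ x) ν := by
  rw [dist, integrable_withDensity_iff_integrable_smul' (hf.measurable θ hθ).ennreal_ofReal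
    (ae_of_all _ fun _ => ENNReal.ofReal_lt_top)]
  refine integrable_congr (ae_of_all _ fun x => ?_)
  simp [ENNReal.toReal_ofReal (hf.nonneg θ hθ x)]

/-- The score in terms of the derivative of `√f`, at a point where `√f` is differentiable along a
coordinate line. At a zero of `f` the derivative of `√f` vanishes. -/
lemma mul_score_eq (hf : IsRegularFamily ν Θ f) {η : Param d} {l : Fin d} {x : X}
    (hη : ∀ᶠ t in 𝓝 0, coordLine η l t ∈ Θ) {g' : ℝ}
    (hg : HasDerivAt (fun t => √(f (coordLine η l t) x)) g' 0) :
    HasDerivAt (fun t => f (coordLine η l t) x) (f η x * score Θ f η x l) 0 ∧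
      f η x * score Θ f η x l = 2 * √(f η x) * g' ∧
      f η x * score Θ f η x l ^ 2 = 4 * g' ^ 2 := by
  have hηΘ : η ∈ Θ := by simpa [coordLine_zero] using hη.self_of_nhds
  have hf0 := hf.nonneg η hηΘ x
  have hsq : HasDerivAt (fun t => f (coordLine η l t) x) (2 * √(f η x) * g') 0 := by
    have h := hg.pow 2
    simp only [coordLine_zero] at h
    refine (h.congr_of_eventuallyEq ?_).congr_deriv (by norm_num)
    filter_upwards [hη] with t ht
    simp [Real.sq_sqrt (hf.nonneg _ ht x)]
  have hscore : score Θ f η x l = deriv (fun t => Real.log (f (coordLine η l t) x)) 0 := by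
    have : {t : ℝ | coordLine η l t ∈ Θ} ∈ 𝓝 0 := hη
    simp only [score, lineDerivWithin]
    exact derivWithin_of_mem_nhds this
  rcases hf0.eq_or_lt with h0 | hpos
  · have hmin : IsLocalMin (fun t => √(f (coordLine η l t) x)) 0 := by
      refine Eventually.of_forall fun t => ?_
      simp only [coordLine_zero, ← h0, Real.sqrt_zero]
      exact Real.sqrt_nonneg _
    have hg0 : g' = 0 := hmin.hasDerivAt_eq_zero hg
    subst hg0
    refine ⟨by simpa [← h0] using hsq, by simp [← h0], by simp [← h0]⟩
  · have hs : score Θ f η x l = 2 * √(f η x) * g' / f η x := by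
      rw [hscore]
      have h := hsq.log (by simpa [coordLine_zero] using hpos.ne')
      simpa [coordLine_zero] using h.deriv
    have hfs : f η x * score Θ f η x l = 2 * √(f η x) * g' := by
      rw [hs]
      field_simp
    refine ⟨hfs ▸ hsq, hfs, ?_⟩
    have : f η x * (f η x * score Θ f η x l ^ 2) = f η x * (4 * g' ^ 2) := by
      calc f η x * (f η x * score Θ f η x l ^ 2) = (f η x * score Θ f η x l) ^ 2 := by ring
        _ = 4 * √(f η x) ^ 2 * g' ^ 2 := by rw [hfs]; ring
        _ = f η x * (4 * g' ^ 2) := by rw [Real.sq_sqrt hf0]; ring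
    exact mul_left_cancel₀ hpos.ne' this

/-- Regularity of the density along a coordinate line inside the cube. -/
lemma ae_line_regular (hf : IsRegularFamily ν Θ f)
    (hΘ : {θ : Param d | ∀ i, θ i ∈ Icc (-B) B} ⊆ Θ) {θ : Param d} (hθ : θ ∈ openCube d B)
    (l : Fin d) :
    ∀ᵐ x ∂ν, (∀ s ∈ Ioo (-B - θ l) (B - θ l),
        HasDerivAt (fun r => f (coordLine θ l r) x)
          (f (coordLine θ l s) x * score Θ f (coordLine θ l s) x l) s) ∧
      ContinuousOn (fun s => f (coordLine θ l s) x * score Θ f (coordLine θ l s) x l)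
        (Ioo (-B - θ l) (B - θ l)) ∧
      ContinuousOn (fun s => f (coordLine θ l s) x * score Θ f (coordLine θ l s) x l ^ 2)
        (Ioo (-B - θ l) (B - θ l)) := by
  filter_upwards [hf.contDiff_sqrt] with x hx
  set J := Ioo (-B - θ l) (B - θ l)
  set G : ℝ → ℝ := fun s => √(f (coordLine θ l s) x) with hG
  have hmem : ∀ s ∈ J, coordLine θ l s ∈ Θ := fun s hs =>
    openCube_subset hΘ (coordLine_mem_openCube hθ hs)
  have hJ : IsOpen J := isOpen_Ioo
  have hGc : ContDiffOn ℝ 1 G J := (hx θ (openCube_subset hΘ hθ) l).mono hmem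
  have hGd : ∀ s ∈ J, HasDerivAt G (deriv G s) s := fun s hs =>
    ((hGc.differentiableOn one_ne_zero).differentiableAt (hJ.mem_nhds hs)).hasDerivAt
  have hG'c : ContinuousOn (deriv G) J := hGc.continuousOn_deriv_of_isOpen hJ le_rfl
  have key : ∀ s ∈ J, HasDerivAt (fun r => f (coordLine θ l r) x)
        (f (coordLine θ l s) x * score Θ f (coordLine θ l s) x l) s ∧
      f (coordLine θ l s) x * score Θ f (coordLine θ l s) x l = 2 * G s * deriv G s ∧
      f (coordLine θ l s) x * score Θ f (coordLine θ l s) x l ^ 2 = 4 * deriv G s ^ 2 := by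
    intro s hs
    have h1 : ∀ᶠ t in 𝓝 0, coordLine (coordLine θ l s) l t ∈ Θ := by
      have : Tendsto (fun t => s + t) (𝓝 0) (𝓝 s) := by
        simpa using! (continuous_const_add s).tendsto 0
      filter_upwards [this (hJ.mem_nhds hs)] with t ht
      rw [coordLine_coordLine]
      exact hmem _ ht
    have h2 : HasDerivAt (fun t => √(f (coordLine (coordLine θ l s) l t) x)) (deriv G s) 0 := by
      simp only [coordLine_coordLine]
      have := hGd s hs
      rw [← add_zero s] at this
      simpa using! this.comp_const_add s 0
    obtain ⟨h3, h4, h5⟩ := mul_score_eq hf h1 h2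
    refine ⟨?_, h4, h5⟩
    simp only [coordLine_coordLine] at h3
    have h6 := HasDerivAt.comp_add_const s (-s) (f := fun t => f (coordLine θ l (s + t)) x)
      (f' := f (coordLine θ l s) x * score Θ f (coordLine θ l s) x l) (by simpa using h3)
    simpa using h6
  refine ⟨fun s hs => (key s hs).1, ?_, ?_⟩
  · exact ((continuousOn_const.mul hGc.continuousOn).mul hG'c).congr fun s hs => (key s hs).2.1
  · exact (continuousOn_const.mul (hG'c.pow 2)).congr fun s hs => (key s hs).2.2

/-- Probabilities of randomized events are differentiable in the parameter, and the derivative is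
the correlation with the score. -/
theorem hasDerivAt_integral_dist (hf : IsRegularFamily ν Θ f)
    (hΘ : {θ : Param d | ∀ i, θ i ∈ Icc (-B) B} ⊆ Θ) {θ : Param d} (hθ : θ ∈ openCube d B)
    (l : Fin d) {w : X → ℝ} (hw : Measurable w) (hw0 : ∀ x, 0 ≤ w x) (hw1 : ∀ x, w x ≤ 1) :
    HasDerivAt (fun s => ∫ x, w x ∂(dist ν f (coordLine θ l s)))
      (∫ x, w x * score Θ f θ x l ∂(dist ν f θ)) 0 := by
  set J := Ioo (-B - θ l) (B - θ l)
  have h0 : (0 : ℝ) ∈ J := zero_mem_line hθ l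
  have hmem : ∀ s ∈ J, coordLine θ l s ∈ Θ := fun s hs =>
    openCube_subset hΘ (coordLine_mem_openCube hθ hs)
  have hreg := ae_line_regular hf hΘ hθ l
  have hfi : ∀ s ∈ J, Integrable (f (coordLine θ l s)) ν := fun s hs => by
    have := hf.isProbabilityMeasure _ (hmem s hs)
    simpa using (integrable_dist_iff hf (hmem s hs) (fun _ => 1)).1 (integrable_const 1)
  have hIi : ∀ s ∈ J, Integrable (fun x => f (coordLine θ l s) x *
      score Θ f (coordLine θ l s) x l ^ 2) ν := fun s hs => by
    simpa [sq] using (integrable_dist_iff hf (hmem s hs) _).1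
      (hf.integrable_fisherInfo _ (hmem s hs) l l)
  -- The dominating function comes from `|S| ≤ 1 + S²`. Its integral is `1` plus a diagonal entry of
  -- the Fisher information, continuous along the line by hypothesis.
  have key := hasDerivAt_integral_of_continuousOn_bound (ν := ν) (a := -B - θ l) (b := B - θ l)
    (F := fun s x => f (coordLine θ l s) x * w x)
    (F' := fun s x => f (coordLine θ l s) x * score Θ f (coordLine θ l s) x l * w x)
    (H := fun s x => f (coordLine θ l s) x +
      f (coordLine θ l s) x * score Θ f (coordLine θ l s) x l ^ 2)
    (fun s hs => (hf.measurable _ (hmem s hs)).mul hw)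
    (fun s hs => (hfi s hs).mono' ((hf.measurable _ (hmem s hs)).mul hw).aestronglyMeasurable
      (ae_of_all _ fun x => by
        have := hf.nonneg _ (hmem s hs) x
        rw [Real.norm_of_nonneg (mul_nonneg this (hw0 x))]
        exact mul_le_of_le_one_right this (hw1 x)))
    (hreg.mono fun x hx s hs => (hx.1 s hs).mul_const _)
    (hreg.mono fun x hx => hx.2.1.mul continuousOn_const)
    (ae_of_all _ fun x s hs => ?_)
    (hreg.mono fun x hx => ContinuousOn.add
      (fun s hs => (hx.1 s hs).continuousAt.continuousWithinAt) hx.2.2)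
    (fun s hs => (hfi s hs).add (hIi s hs)) ?_ h0
  · simp only [coordLine_zero] at key
    rw [integral_dist hf (openCube_subset hΘ hθ)]
    refine (key.congr_of_eventuallyEq ?_).congr_deriv ?_
    · filter_upwards [isOpen_Ioo.mem_nhds h0] with s hs
      exact integral_dist hf (hmem s hs) w
    · refine integral_congr_ae (ae_of_all _ fun x => ?_)
      ring
  · have h1 := hf.nonneg _ (hmem s hs) x
    set S := score Θ f (coordLine θ l s) x l
    rw [abs_mul, abs_mul, abs_of_nonneg h1, abs_of_nonneg (hw0 x), ← mul_one_add, mul_assoc]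
    refine mul_le_mul_of_nonneg_left ?_ h1
    calc |S| * w x ≤ |S| := mul_le_of_le_one_right (abs_nonneg _) (hw1 x)
      _ ≤ 1 + S ^ 2 := by
        rw [← sq_abs S]
        nlinarith [sq_nonneg (|S| - 1), abs_nonneg S]
  · have hI : ContinuousOn (fun s => 1 + fisherInfo ν Θ f (coordLine θ l s) l l) J :=
      continuousOn_const.add
        ((hf.continuous_fisherInfo θ (openCube_subset hΘ hθ) l l l).mono hmem)
    refine hI.congr fun s hs => ?_
    have := hf.isProbabilityMeasure _ (hmem s hs)
    simp only [fisherInfo, Matrix.of_apply]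
    rw [integral_dist hf (hmem s hs), integral_add (hfi s hs) (hIi s hs)]
    congr 1
    · have h := integral_dist hf (hmem s hs) (fun _ => 1)
      simpa using h.symm
    · refine integral_congr_ae (ae_of_all _ fun x => ?_)
      simp only
      ring

/-- The product `f S` is a partial derivative of `f`, hence a limit of measurable difference
quotients, and division by `f` is harmless because `f ≠ 0` almost everywhere for `P_θ`. -/
lemma aestronglyMeasurable_score (hf : IsRegularFamily ν Θ f)
    (hΘ : {θ : Param d | ∀ i, θ i ∈ Icc (-B) B} ⊆ Θ) {θ : Param d} (hθ : θ ∈ openCube d B)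
    (l : Fin d) : AEStronglyMeasurable (fun x => score Θ f θ x l) (dist ν f θ) := by
  have hmem : ∀ s ∈ Ioo (-B - θ l) (B - θ l), coordLine θ l s ∈ Θ := fun s hs =>
    openCube_subset hΘ (coordLine_mem_openCube hθ hs)
  have hθΘ := openCube_subset hΘ hθ
  have h1 := aestronglyMeasurable_of_hasDerivAt (ν := ν) (F := fun s x => f (coordLine θ l s) x)
    (fun s hs => hf.measurable _ (hmem s hs))
    ((ae_line_regular hf hΘ hθ l).mono fun x hx => hx.1) (zero_mem_line hθ l)
  simp only [coordLine_zero] at h1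
  have h2 : AEMeasurable (fun x => (f θ x)⁻¹ * (f θ x * score Θ f θ x l)) (dist ν f θ) :=
    ((hf.measurable θ hθΘ).inv.aemeasurable).mul
      (h1.mono_ac (withDensity_absolutelyContinuous _ _)).aemeasurable
  refine (h2.congr ?_).aestronglyMeasurable
  rw [dist, EventuallyEq, ae_withDensity_iff (hf.measurable θ hθΘ).ennreal_ofReal]
  refine ae_of_all _ fun x hx => ?_
  have : f θ x ≠ 0 := fun h => hx (by simp [h])
  field_simp

lemma memLp_score (hf : IsRegularFamily ν Θ f)
    (hΘ : {θ : Param d | ∀ i, θ i ∈ Icc (-B) B} ⊆ Θ) {θ : Param d} (hθ : θ ∈ openCube d B)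
    (l : Fin d) : MemLp (fun x => score Θ f θ x l) 2 (dist ν f θ) := by
  rw [memLp_two_iff_integrable_sq (aestronglyMeasurable_score hf hΘ hθ l)]
  simpa [sq] using hf.integrable_fisherInfo θ (openCube_subset hΘ hθ) l l

/-- Differentiate the constant total mass: the weight `w = 1` in `hasDerivAt_integral_dist`. -/
lemma integral_score (hf : IsRegularFamily ν Θ f)
    (hΘ : {θ : Param d | ∀ i, θ i ∈ Icc (-B) B} ⊆ Θ) {θ : Param d} (hθ : θ ∈ openCube d B)
    (l : Fin d) : ∫ x, score Θ f θ x l ∂(dist ν f θ) = 0 := by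
  have h := hasDerivAt_integral_dist hf hΘ hθ l (w := fun _ => 1) measurable_const
    (fun _ => zero_le_one) fun _ => le_rfl
  simp only [one_mul] at h
  refine h.unique ((hasDerivAt_const (0 : ℝ) (1 : ℝ)).congr_of_eventuallyEq ?_)
  filter_upwards [isOpen_Ioo.mem_nhds (zero_mem_line hθ l)] with s hs
  have := hf.isProbabilityMeasure _ (openCube_subset hΘ (coordLine_mem_openCube hθ hs))
  simp

end Model

end QuantizedEstimation

namespace QuantizedEstimation

/-! ### Transcript probabilities factor over the nodes. -/

section Factorization

/-- The path probabilities of a finite tree with transition probabilities `κ` sum to one. -/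
lemma sum_prod_prefix_eq_one {A : Type*} [Fintype A] {N : ℕ}
    (κ : (t : Fin N) → (Fin t → A) → A → ℝ) (hκ : ∀ t v, ∑ a, κ t v a = 1) :
    ∑ y : Fin N → A, ∏ t, κ t (fun s => y (s.castLE t.isLt.le)) (y t) = 1 := by
  induction N with
  | zero => simp
  | succ N ih =>
    rw [← (Fin.snocEquiv fun _ : Fin (N + 1) => A).sum_comp, Fintype.sum_prod_type_right]
    have ih' := ih (fun t => κ t.castSucc) fun t v => hκ t.castSucc v
    rw [← ih']
    refine Finset.sum_congr rfl fun y _ => ?_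
    have h1 : ∀ (a : A) (t : Fin N),
        (fun s : Fin t => (Fin.snoc y a : Fin (N + 1) → A) (s.castLE (by omega))) =
          fun s => y (s.castLE t.isLt.le) := by
      intro a t
      funext s
      exact Fin.snoc_castSucc (α := fun _ => A) a y (s.castLE t.isLt.le)
    have h2 : ∀ a : A, (fun s : Fin N => (Fin.snoc y a : Fin (N + 1) → A) (s.castLE (by omega))) =
        y := by
      intro a
      funext s
      exact Fin.snoc_castSucc (α := fun _ => A) a y s
    have h3 : ∀ a : A, ∏ t, κ t (fun s => (Fin.snoc y a : Fin (N + 1) → A)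
          (s.castLE t.isLt.le)) ((Fin.snoc y a : Fin (N + 1) → A) t) =
        (∏ t : Fin N, κ t.castSucc (fun s => y (s.castLE t.isLt.le)) (y t)) *
          κ (Fin.last N) y a := by
      intro a
      rw [Fin.prod_univ_castSucc]
      congr 1
      · refine Finset.prod_congr rfl fun t _ => ?_
        rw [Fin.snoc_castSucc]
        exact congrArg (fun v => κ t.castSucc v (y t)) (h1 a t)
      · rw [Fin.snoc_last]
        exact congrArg (fun v => κ (Fin.last N) v a) (h2 a)
    change ∑ a, ∏ t, κ t (fun s => (Fin.snoc y a : Fin (N + 1) → A)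
          (s.castLE t.isLt.le)) ((Fin.snoc y a : Fin (N + 1) → A) t) = _
    rw [Finset.sum_congr rfl fun a _ => h3 a, ← Finset.mul_sum, hκ, mul_one]
    rfl

variable {X : Type*} [MeasurableSpace X] {n k : ℕ}

/-- The conditional probabilities of a transcript given the samples factor over the nodes. The
normalization that omits node `i` expresses that this node writes `k` bits. -/
structure IsFactorization (c : Protocol X n k) (w : c.Transcript → Fin n → X → ℝ) : Prop where
  measurable : ∀ y i, Measurable (w y i)
  nonneg : ∀ y i x, 0 ≤ w y i x
  le_one : ∀ y i x, w y i x ≤ 1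
  condProb_eq : ∀ x y, c.condProb x y = ∏ i, w y i (x i)
  sum_prod : ∀ x : Fin n → X, ∑ y, ∏ i, w y i (x i) = 1
  sum_prod_erase : ∀ (i : Fin n) (x : Fin n → X),
    ∑ y, ∏ j ∈ Finset.univ.erase i, w y j (x j) = 2 ^ k
  eq_one : k = 0 → ∀ y i x, w y i x = 1

lemma Quantizer.prob_le_one (q : Quantizer X k) (m : Fin (2 ^ k)) (x : X) : q.prob m x ≤ 1 := by
  rw [← q.sum_eq_one x]
  exact Finset.single_le_sum (f := fun m => q.prob m x) (fun m _ => q.nonneg m x)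
    (Finset.mem_univ m)

/-- For `sum_prod_erase`, replace the transition probabilities of node `i` by the uniform value
`2^(-k)`. They still sum to one, so the path probabilities do too, and the constant factors out even
though later nodes depend on the message of node `i`. -/
lemma isFactorization_sequential (q : (i : Fin n) → (Fin i → Fin (2 ^ k)) → Quantizer X k) :
    IsFactorization (.sequential q) fun (m : Fin n → Fin (2 ^ k)) i =>
      (q i fun j => m (j.castLE i.isLt.le)).prob (m i) where
  measurable _ _ := (q _ _).measurable _
  nonneg _ _ := (q _ _).nonneg _
  le_one _ _ := (q _ _).prob_le_one _
  condProb_eq _ _ := rfl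
  sum_prod x := sum_prod_prefix_eq_one (fun t v a => (q t v).prob a (x t))
    fun t v => (q t v).sum_eq_one (x t)
  sum_prod_erase i x := by
    have h := sum_prod_prefix_eq_one
      (fun (t : Fin n) v (a : Fin (2 ^ k)) =>
        if t = i then ((2 : ℝ) ^ k)⁻¹ else (q t v).prob a (x t)) (fun t v => by
          split_ifs
          · simp
          · exact (q t v).sum_eq_one (x t))
    have h2 : ∀ y : Fin n → Fin (2 ^ k),
        (∏ t : Fin n, if t = i then ((2 : ℝ) ^ k)⁻¹ else
          (q t fun s => y (s.castLE t.isLt.le)).prob (y t) (x t)) =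
        ((2 : ℝ) ^ k)⁻¹ * ∏ t ∈ Finset.univ.erase i,
          (q t fun s => y (s.castLE t.isLt.le)).prob (y t) (x t) := by
      intro y
      rw [← Finset.mul_prod_erase _ _ (Finset.mem_univ i), if_pos rfl]
      congr 1
      refine Finset.prod_congr rfl fun t ht => ?_
      rw [if_neg (Finset.ne_of_mem_erase ht)]
    rw [Finset.sum_congr rfl fun y _ => h2 y, ← Finset.mul_sum,
      inv_mul_eq_one₀ (by positivity)] at h
    exact h.symm
  eq_one hk m i x := by
    subst hk
    have : Subsingleton (Fin (2 ^ 0)) := by rw [pow_zero]; infer_instance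
    have h := (q i fun j => m (j.castLE i.isLt.le)).sum_eq_one x
    rwa [Fintype.sum_subsingleton _ (m i)] at h

/-- The probability that a blackboard bit written at a given vertex equals `a`. -/
noncomputable def Blackboard.bitProb (b : Blackboard X n k) (t : Fin (n * k)) (v : Fin t → Bool)
    (a : Bool) (x : X) : ℝ :=
  if a then b.bit t v x else 1 - b.bit t v x

/-- The factor of a node collects the bits it writes along the path. For `sum_prod_erase`, these
bits become fair coin flips; as each path has exactly `k` vertices labelled `i`, they contribute the
same constant `2^(-k)` on every path. -/
lemma isFactorization_blackboard (b : Blackboard X n k) :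
    IsFactorization (.blackboard b) fun (y : Fin (n * k) → Bool) i x =>
      ∏ t with b.label t (fun s => y (s.castLE t.isLt.le)) = i,
        b.bitProb t (fun s => y (s.castLE t.isLt.le)) (y t) x where
  measurable y i := by
    refine Finset.measurable_fun_prod _ fun t _ => ?_
    unfold Blackboard.bitProb
    split_ifs
    · exact b.measurable _ _
    · exact measurable_const.sub (b.measurable _ _)
  nonneg y i x := by
    refine Finset.prod_nonneg fun t _ => ?_
    unfold Blackboard.bitProb
    have := b.mem_Icc t (fun s => y (s.castLE t.isLt.le)) x
    split_ifs
    · exact this.1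
    · linarith [this.2]
  le_one y i x := by
    refine Finset.prod_le_one (fun t _ => ?_) fun t _ => ?_ <;>
    · unfold Blackboard.bitProb
      have := b.mem_Icc t (fun s => y (s.castLE t.isLt.le)) x
      split_ifs <;> linarith [this.1, this.2]
  condProb_eq x (y : Fin (n * k) → Bool) := by
    change ∏ t : Fin (n * k), b.bitProb t (fun s => y (s.castLE t.isLt.le)) (y t)
      (x (b.label t fun s => y (s.castLE t.isLt.le))) = _
    rw [← Finset.prod_fiberwise Finset.univ
      fun t : Fin (n * k) => b.label t (fun s => y (s.castLE t.isLt.le))]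
    refine Finset.prod_congr rfl fun i _ => Finset.prod_congr rfl fun t ht => ?_
    rw [Finset.mem_filter] at ht
    rw [ht.2]
  sum_prod x := by
    have h := sum_prod_prefix_eq_one
      (fun (t : Fin (n * k)) v a => b.bitProb t v a (x (b.label t v)))
      (fun t v => by simp [Blackboard.bitProb])
    rw [← h]
    refine Finset.sum_congr rfl fun (y : Fin (n * k) → Bool) _ => ?_
    rw [← Finset.prod_fiberwise Finset.univ
      fun t : Fin (n * k) => b.label t (fun s => y (s.castLE t.isLt.le))]
    refine Finset.prod_congr rfl fun i _ => Finset.prod_congr rfl fun t ht => ?_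
    rw [Finset.mem_filter] at ht
    rw [ht.2]
  sum_prod_erase i x := by
    have h := sum_prod_prefix_eq_one
      (fun (t : Fin (n * k)) v a =>
        if b.label t v = i then (2 : ℝ)⁻¹ else b.bitProb t v a (x (b.label t v)))
      (fun t v => by split_ifs <;> simp [Blackboard.bitProb])
    have h2 : ∀ y : Fin (n * k) → Bool,
        (∏ t : Fin (n * k), if b.label t (fun s => y (s.castLE t.isLt.le)) = i then (2 : ℝ)⁻¹ else
          b.bitProb t (fun s => y (s.castLE t.isLt.le)) (y t)
            (x (b.label t (fun s => y (s.castLE t.isLt.le))))) =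
        ((2 : ℝ) ^ k)⁻¹ * ∏ j ∈ Finset.univ.erase i,
          ∏ t with b.label t (fun s => y (s.castLE t.isLt.le)) = j,
            b.bitProb t (fun s => y (s.castLE t.isLt.le)) (y t) (x j) := by
      intro y
      rw [← Finset.prod_fiberwise Finset.univ
        fun t : Fin (n * k) => b.label t (fun s => y (s.castLE t.isLt.le)),
        ← Finset.mul_prod_erase _ _ (Finset.mem_univ i)]
      congr 1
      · rw [Finset.prod_congr rfl (g := fun _ => (2 : ℝ)⁻¹), Finset.prod_const, b.card_label y i,
          inv_pow]
        intro t ht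
        rw [if_pos (Finset.mem_filter.1 ht).2]
      · refine Finset.prod_congr rfl fun j hj => Finset.prod_congr rfl fun t ht => ?_
        rw [Finset.mem_filter] at ht
        rw [if_neg (by rw [ht.2]; exact Finset.ne_of_mem_erase hj), ht.2]
    rw [Finset.sum_congr rfl fun y _ => h2 y, ← Finset.mul_sum,
      inv_mul_eq_one₀ (by positivity)] at h
    exact h.symm
  eq_one hk y i x := by
    subst hk
    exact Finset.prod_eq_one fun t _ => absurd t.isLt (by simp)

theorem Protocol.exists_isFactorization (c : Protocol X n k) :
    ∃ w, IsFactorization c w := by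
  cases c with
  | independent q =>
    -- An independent protocol is a sequential one that ignores the history; transcripts and
    -- conditional probabilities agree definitionally, so the fields carry over.
    obtain ⟨h1, h2, h3, h4, h5, h6, h7⟩ := isFactorization_sequential fun i _ => q i
    exact ⟨_, h1, h2, h3, h4, h5, h6, h7⟩
  | sequential q => exact ⟨_, isFactorization_sequential q⟩
  | blackboard b => exact ⟨_, isFactorization_blackboard b⟩

end Factorization

end QuantizedEstimation

namespace QuantizedEstimation

open Filter Topology

/-! ### Correlation of a randomized event with a random variable. -/

section Weight

variable {X : Type*} [MeasurableSpace X] {d : ℕ} {P : Measure X} {w : X → ℝ}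

lemma integrable_weight_mul (hw : Measurable w) (hw0 : ∀ x, 0 ≤ w x) (hw1 : ∀ x, w x ≤ 1)
    {Z : X → ℝ} (hZ : Integrable Z P) : Integrable (fun x => w x * Z x) P := by
  refine hZ.norm.mono' (hw.aestronglyMeasurable.mul hZ.1) (ae_of_all _ fun x => ?_)
  rw [norm_mul, Real.norm_of_nonneg (hw0 x)]
  exact mul_le_of_le_one_left (norm_nonneg _) (hw1 x)

lemma integrable_weight [IsProbabilityMeasure P] (hw : Measurable w) (hw0 : ∀ x, 0 ≤ w x)
    (hw1 : ∀ x, w x ≤ 1) : Integrable w P := by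
  simpa using integrable_weight_mul hw hw0 hw1 (integrable_const (μ := P) (1 : ℝ))

lemma integral_weight_le_one [IsProbabilityMeasure P] (hw : Measurable w) (hw0 : ∀ x, 0 ≤ w x)
    (hw1 : ∀ x, w x ≤ 1) : ∫ x, w x ∂P ≤ 1 := by
  simpa using integral_mono (integrable_weight (P := P) hw hw0 hw1) (integrable_const 1) hw1

lemma integral_weight_mul_eq_zero [IsProbabilityMeasure P] (hw : Measurable w)
    (hw0 : ∀ x, 0 ≤ w x) (hw1 : ∀ x, w x ≤ 1) (h : ∫ x, w x ∂P = 0) (Z : X → ℝ) :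
    ∫ x, w x * Z x ∂P = 0 := by
  have h0 := (integral_eq_zero_iff_of_nonneg hw0 (integrable_weight hw hw0 hw1)).1 h
  refine integral_eq_zero_of_ae ?_
  filter_upwards [h0] with x hx
  simp [hx]

/-- Cauchy–Schwarz for the measure `w P`, followed by `w ≤ 1`. The first step is nonnegativity of
the weighted second moment about the conditional mean `N / q`. -/
lemma sq_integral_weight_mul_le [IsProbabilityMeasure P] (hw : Measurable w)
    (hw0 : ∀ x, 0 ≤ w x) (hw1 : ∀ x, w x ≤ 1) {Z : X → ℝ} (hZ : MemLp Z 2 P) :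
    (∫ x, w x * Z x ∂P) ^ 2 ≤ (∫ x, w x ∂P) * ∫ x, Z x ^ 2 ∂P := by
  have hq0 : 0 ≤ ∫ x, w x ∂P := integral_nonneg hw0
  rcases hq0.eq_or_lt with h | hq
  · rw [integral_weight_mul_eq_zero hw hw0 hw1 h.symm, ← h]
    simp
  set q := ∫ x, w x ∂P with hqdef
  set N := ∫ x, w x * Z x ∂P with hN
  have hi0 := integrable_weight (P := P) hw hw0 hw1
  have hi1 := integrable_weight_mul hw hw0 hw1 (hZ.integrable one_le_two)
  have hi2 := integrable_weight_mul hw hw0 hw1 hZ.integrable_sq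
  have h1 : 0 ≤ ∫ x, w x * (Z x - N / q) ^ 2 ∂P :=
    integral_nonneg fun x => mul_nonneg (hw0 x) (sq_nonneg _)
  have h2 : ∫ x, w x * (Z x - N / q) ^ 2 ∂P =
      ∫ x, w x * Z x ^ 2 ∂P - 2 * (N / q) * N + (N / q) ^ 2 * q := by
    have : ∀ x, w x * (Z x - N / q) ^ 2 =
        w x * Z x ^ 2 - 2 * (N / q) * (w x * Z x) + (N / q) ^ 2 * w x := fun x => by ring
    simp only [this]
    rw [integral_add (by exact hi2.sub (hi1.const_mul _)) (hi0.const_mul _),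
      integral_sub hi2 (hi1.const_mul _), integral_const_mul, integral_const_mul]
  have h3 : ∫ x, w x * Z x ^ 2 ∂P ≤ ∫ x, Z x ^ 2 ∂P :=
    integral_mono hi2 hZ.integrable_sq fun x => mul_le_of_le_one_left (sq_nonneg _) (hw1 x)
  rw [h2] at h1
  have h4 : N ^ 2 / q ≤ ∫ x, Z x ^ 2 ∂P := by
    have : 2 * (N / q) * N - (N / q) ^ 2 * q = N ^ 2 / q := by
      field_simp
      ring
    linarith
  rwa [div_le_iff₀' hq] at h4

lemma inner_param_eq (u v : Param d) : inner ℝ u v = ∑ l, u l * v l := by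
  simp [PiLp.inner_apply, mul_comm]

lemma memLp_inner {S : X → Param d} (hS : ∀ l, MemLp (fun x => S x l) 2 P) (u : Param d) :
    MemLp (fun x => inner ℝ u (S x)) 2 P := by
  simp only [inner_param_eq]
  exact memLp_finsetSum _ fun l _ => (hS l).const_mul (u l)

lemma integral_weight_mul_inner [IsProbabilityMeasure P] (hw : Measurable w)
    (hw0 : ∀ x, 0 ≤ w x) (hw1 : ∀ x, w x ≤ 1) {S : X → Param d}
    (hS : ∀ l, MemLp (fun x => S x l) 2 P) (u : Param d) :
    ∫ x, w x * inner ℝ u (S x) ∂P = ∑ l, u l * ∫ x, w x * S x l ∂P := by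
  simp only [inner_param_eq, Finset.mul_sum]
  rw [integral_finsetSum]
  · refine Finset.sum_congr rfl fun l _ => ?_
    rw [← integral_const_mul]
    refine integral_congr_ae (ae_of_all _ fun x => ?_)
    simp only
    ring
  · intro l _
    exact integrable_weight_mul hw hw0 hw1 (((hS l).integrable one_le_two).const_mul _)

/-- A bound on the correlation with all one-dimensional projections of the score bounds the whole
vector of correlations. -/
lemma sum_sq_integral_weight_mul_le [IsProbabilityMeasure P] (hw : Measurable w)
    (hw0 : ∀ x, 0 ≤ w x) (hw1 : ∀ x, w x ≤ 1) {S : X → Param d}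
    (hS : ∀ l, MemLp (fun x => S x l) 2 P) {C : ℝ} (hC : 0 ≤ C)
    (h : ∀ u : Param d, ‖u‖ = 1 → (∫ x, w x * inner ℝ u (S x) ∂P) ^ 2 ≤ C) :
    ∑ l, (∫ x, w x * S x l ∂P) ^ 2 ≤ C := by
  set G : Param d := WithLp.toLp 2 fun l => ∫ x, w x * S x l ∂P with hG
  have hG2 : ∑ l, (∫ x, w x * S x l ∂P) ^ 2 = ‖G‖ ^ 2 := by
    simp [EuclideanSpace.real_norm_sq_eq, hG]
  rw [hG2]
  by_cases h0 : G = 0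
  · simpa [h0] using hC
  have hn : ‖G‖ ≠ 0 := norm_ne_zero_iff.2 h0
  have h1 := h (‖G‖⁻¹ • G) (norm_smul_inv_norm (𝕜 := ℝ) h0)
  rw [integral_weight_mul_inner hw hw0 hw1 hS] at h1
  have h2 : ∑ l, (‖G‖⁻¹ • G) l * ∫ x, w x * S x l ∂P = ‖G‖ := by
    have : ∑ l, (‖G‖⁻¹ • G) l * ∫ x, w x * S x l ∂P =
        ‖G‖⁻¹ * ∑ l, (∫ x, w x * S x l ∂P) ^ 2 := by
      rw [Finset.mul_sum]
      refine Finset.sum_congr rfl fun l _ => ?_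
      simp only [hG, PiLp.smul_apply, smul_eq_mul]
      ring
    rw [this, hG2]
    field_simp
  rwa [h2] at h1

/-- The tangent at `A` of the convex function `exp(z^p)`, obtained from Bernoulli's inequality for
`z^p` and then `1 + x ≤ exp x`. -/
lemma exp_rpow_tangent_le {p A z : ℝ} (hp : 1 ≤ p) (hA : 0 < A) (hz : 0 ≤ z) :
    Real.exp (A ^ p) * (1 + p * A ^ (p - 1) * (z - A)) ≤ Real.exp (z ^ p) := by
  have h1 : A ^ p + p * A ^ (p - 1) * (z - A) ≤ z ^ p := by
    have hb := one_add_mul_self_le_rpow_one_add (s := z / A - 1)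
      (by have := div_nonneg hz hA.le; linarith) hp
    have hb2 := mul_le_mul_of_nonneg_left hb (Real.rpow_pos_of_pos hA p).le
    have e1 : A ^ p * (1 + (z / A - 1)) ^ p = z ^ p := by
      rw [← Real.mul_rpow hA.le (by have := div_nonneg hz hA.le; linarith)]
      congr 1
      field_simp
      ring
    have e2 : A ^ p = A ^ (p - 1) * A := by
      rw [Real.rpow_sub_one hA.ne']
      field_simp
    rw [e1] at hb2
    refine le_trans (le_of_eq ?_) hb2
    rw [e2]
    field_simp
  have h2 := Real.add_one_le_exp (z ^ p - A ^ p)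
  calc Real.exp (A ^ p) * (1 + p * A ^ (p - 1) * (z - A))
      ≤ Real.exp (A ^ p) * Real.exp (z ^ p - A ^ p) :=
        mul_le_mul_of_nonneg_left (by linarith) (Real.exp_pos _).le
    _ = Real.exp (z ^ p) := by rw [← Real.exp_add]; congr 1; ring

/-- The defining inequality of the Orlicz norm holds for every larger constant. -/
lemma lintegral_le_one_of_orliczNorm_lt {p : ℝ} (hp : 1 ≤ p) {Z : X → ℝ} {K : ℝ}
    (h : orliczNorm p Z P < ENNReal.ofReal K) :
    0 < K ∧ ∫⁻ x, ENNReal.ofReal (Real.exp ((|Z x| / K) ^ p) - 1) ∂P ≤ 1 := by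
  simp only [orliczNorm, iInf_lt_iff] at h
  obtain ⟨K', hK', h1, h2⟩ := h
  have hK : K' < K := (ENNReal.ofReal_lt_ofReal_iff_of_nonneg hK'.le).1 h2
  refine ⟨hK'.trans hK, (lintegral_mono fun x => ?_).trans h1⟩
  have := hK'.trans hK
  gcongr

/-- Jensen for `exp(z^p)` under the law with density `w / q`: the conditional mean `A` of `Z`, in
absolute value and scaled by `K`, satisfies `q exp(A^p) ≤ ∫ w exp((|Z| / K)^p) ≤ 2`. Taking
logarithms leaves `log 2 - log q`, and `log 2 < 1`. The tangent line at `A` replaces an appeal to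
Jensen. -/
lemma rpow_le_log_of_lintegral_le_one [IsProbabilityMeasure P] (hw : Measurable w)
    (hw0 : ∀ x, 0 ≤ w x) (hw1 : ∀ x, w x ≤ 1) {p : ℝ} (hp : 1 ≤ p) {Z : X → ℝ}
    (hZ : Integrable Z P) {K : ℝ} (hK : 0 < K)
    (h : ∫⁻ x, ENNReal.ofReal (Real.exp ((|Z x| / K) ^ p) - 1) ∂P ≤ 1)
    (hq : 0 < ∫ x, w x ∂P) :
    (|∫ x, w x * Z x ∂P| / (∫ x, w x ∂P) / K) ^ p ≤ 1 - Real.log (∫ x, w x ∂P) := by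
  set q := ∫ x, w x ∂P with hqdef
  have hq1 : q ≤ 1 := integral_weight_le_one hw hw0 hw1
  have hlog : Real.log q ≤ 0 := Real.log_nonpos hq.le hq1
  set A := |∫ x, w x * Z x ∂P| / q / K with hAdef
  have hA0 : 0 ≤ A := by positivity
  rcases hA0.eq_or_lt with hA | hA
  · rw [← hA, Real.zero_rpow (by linarith)]
    linarith
  set E : X → ℝ := fun x => Real.exp ((|Z x| / K) ^ p) with hE
  have hE1 : ∀ x, 0 ≤ E x - 1 := fun x => by
    have : 0 ≤ (|Z x| / K) ^ p := by positivity
    linarith [Real.add_one_le_exp ((|Z x| / K) ^ p)]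
  have hEm : AEStronglyMeasurable (fun x => E x - 1) P := by
    refine AEMeasurable.aestronglyMeasurable ?_
    exact (Real.measurable_exp.comp_aemeasurable
      (((hZ.1.aemeasurable.norm).div_const K).pow_const p)).sub_const 1
  have hEi1 : Integrable (fun x => E x - 1) P :=
    ⟨hEm, (hasFiniteIntegral_iff_ofReal (ae_of_all _ hE1)).2 (h.trans_lt ENNReal.one_lt_top)⟩
  have hEi : Integrable E P := 
    (hEi1.add (integrable_const 1)).congr (ae_of_all _ fun x => by simp)
  have hE2 : ∫ x, E x ∂P ≤ 2 := by
    have : ∫ x, (E x - 1) ∂P ≤ 1 := by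
      rw [integral_eq_lintegral_of_nonneg_ae (ae_of_all _ hE1) hEm]
      exact ENNReal.toReal_le_of_le_ofReal zero_le_one (by simpa using h)
    rw [integral_sub hEi (integrable_const 1)] at this
    simp only [integral_const, probReal_univ, smul_eq_mul, mul_one] at this
    linarith
  have hwE : ∫ x, w x * E x ∂P ≤ 2 :=
    (integral_mono (integrable_weight_mul hw hw0 hw1 hEi) hEi fun x =>
      mul_le_of_le_one_left (Real.exp_pos _).le (hw1 x)).trans hE2
  have hwi := integrable_weight (P := P) hw hw0 hw1
  have hwZ := integrable_weight_mul hw hw0 hw1 hZ.abs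
  set c := p * A ^ (p - 1) with hc
  have hc0 : 0 ≤ c := by positivity
  have hint : Integrable (fun x => Real.exp (A ^ p) *
      ((1 - c * A) * w x + c / K * (w x * |Z x|))) P :=
    ((hwi.const_mul _).add (hwZ.const_mul _)).const_mul _
  have hlow : Real.exp (A ^ p) * ((1 - c * A) * q + c / K * ∫ x, w x * |Z x| ∂P) ≤
      ∫ x, w x * E x ∂P := by
    rw [hqdef, ← integral_const_mul, ← integral_const_mul,
      ← integral_add (hwi.const_mul _) (hwZ.const_mul _), ← integral_const_mul]
    refine integral_mono hint (integrable_weight_mul hw hw0 hw1 hEi) fun x => ?_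
    have h1 := mul_le_mul_of_nonneg_left
      (exp_rpow_tangent_le hp hA (div_nonneg (abs_nonneg (Z x)) hK.le)) (hw0 x)
    refine le_trans (le_of_eq ?_) h1
    simp only [← hc]
    ring
  have habs : A * q * K ≤ ∫ x, w x * |Z x| ∂P := by
    have h1 : A * q * K = |∫ x, w x * Z x ∂P| := by
      rw [hAdef]
      field_simp
    rw [h1]
    refine (abs_integral_le_integral_abs).trans (le_of_eq ?_)
    refine integral_congr_ae (ae_of_all _ fun x => ?_)
    simp [abs_mul, abs_of_nonneg (hw0 x)]
  have hfin : Real.exp (A ^ p) * q ≤ 2 := by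
    refine le_trans (mul_le_mul_of_nonneg_left ?_ (Real.exp_pos _).le) (hlow.trans hwE)
    have h1 : c / K * (A * q * K) ≤ c / K * ∫ x, w x * |Z x| ∂P :=
      mul_le_mul_of_nonneg_left habs (by positivity)
    have h2 : c / K * (A * q * K) = c * A * q := by field_simp
    linarith
  have h3 : A ^ p + Real.log q ≤ Real.log 2 := by
    rw [← Real.log_exp (A ^ p), ← Real.log_mul (Real.exp_pos _).ne' hq.ne']
    exact Real.log_le_log (by positivity) hfin
  have := Real.log_two_lt_d9
  linarith

lemma sq_integral_weight_mul_le_of_orliczNorm [IsProbabilityMeasure P] (hw : Measurable w)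
    (hw0 : ∀ x, 0 ≤ w x) (hw1 : ∀ x, w x ≤ 1) {p I₀ : ℝ} (hp : 1 ≤ p) (hI₀ : 0 ≤ I₀) {Z : X → ℝ}
    (hZ : Integrable Z P) (h : orliczNorm p Z P ^ 2 ≤ ENNReal.ofReal I₀) :
    (∫ x, w x * Z x ∂P) ^ 2 ≤
      (∫ x, w x ∂P) ^ 2 * (I₀ * (1 - Real.log (∫ x, w x ∂P)) ^ (2 / p)) := by
  have hq0 : 0 ≤ ∫ x, w x ∂P := integral_nonneg hw0
  rcases hq0.eq_or_lt with hq | hq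
  · rw [integral_weight_mul_eq_zero hw hw0 hw1 hq.symm, ← hq]
    simp
  set q := ∫ x, w x ∂P
  set v := 1 - Real.log q with hv
  have hv1 : 1 ≤ v := by
    have := Real.log_nonpos hq.le (integral_weight_le_one (P := P) hw hw0 hw1)
    linarith
  have hnorm : orliczNorm p Z P ≤ ENNReal.ofReal √I₀ := by
    rw [← Real.sq_sqrt hI₀, ENNReal.ofReal_pow (Real.sqrt_nonneg _)] at h
    exact (ENNReal.pow_le_pow_left_iff two_ne_zero).1 h
  -- The infimum defining the norm need not be known to be attained, so the estimate is made for
  -- every `K > √I₀` and then `K` decreases to `√I₀`.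
  have key : ∀ K, √I₀ < K → |∫ x, w x * Z x ∂P| / q ≤ K * v ^ (1 / p) := by
    intro K hK
    have hK0 : 0 < K := (Real.sqrt_nonneg _).trans_lt hK
    obtain ⟨-, h1⟩ := lintegral_le_one_of_orliczNorm_lt hp
      (hnorm.trans_lt ((ENNReal.ofReal_lt_ofReal_iff hK0).2 hK))
    have h2 := rpow_le_log_of_lintegral_le_one hw hw0 hw1 hp hZ hK0 h1 hq
    have h3 := Real.rpow_le_rpow (by positivity) h2 (z := 1 / p) (by positivity)
    rw [← Real.rpow_mul (by positivity), mul_one_div_cancel (by positivity), Real.rpow_one,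
      div_le_iff₀' hK0] at h3
    exact h3
  have hlim : |∫ x, w x * Z x ∂P| / q ≤ √I₀ * v ^ (1 / p) := by
    have ht : Tendsto (fun K => K * v ^ (1 / p)) (𝓝[>] √I₀) (𝓝 (√I₀ * v ^ (1 / p))) :=
      ((continuous_id.mul continuous_const).tendsto _).mono_left nhdsWithin_le_nhds
    exact ge_of_tendsto ht (eventually_mem_nhdsWithin.mono fun K hK => key K hK)
  rw [div_le_iff₀ hq] at hlim
  calc (∫ x, w x * Z x ∂P) ^ 2 = |∫ x, w x * Z x ∂P| ^ 2 := (sq_abs _).symm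
    _ ≤ (√I₀ * v ^ (1 / p) * q) ^ 2 := pow_le_pow_left₀ (abs_nonneg _) hlim 2
    _ = q ^ 2 * (√I₀ ^ 2 * (v ^ (1 / p)) ^ 2) := by ring
    _ = q ^ 2 * (I₀ * v ^ (2 / p)) := by
      rw [Real.sq_sqrt hI₀, ← Real.rpow_natCast (v ^ (1 / p)), ← Real.rpow_mul (by linarith)]
      congr 3
      push_cast
      ring

end Weight

/-! ### A tangent inequality for the squared logarithm. -/

section Entropy

/-- The difference of the two sides vanishes at `0` and has derivative `2τ(1 - exp(-τ)) ≥ 0`. This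
is the extremal case `v = 1`, `L = 1 + τ` of `sq_le_tangent`. -/
lemma two_sub_sq_le {τ : ℝ} (hτ : 0 ≤ τ) : 2 - τ ^ 2 ≤ 2 * (1 + τ) * Real.exp (-τ) := by
  have hd : ∀ x : ℝ, HasDerivAt (fun τ => 2 * (1 + τ) * Real.exp (-τ) - (2 - τ ^ 2))
      (2 * x * (1 - Real.exp (-x))) x := by
    intro x
    have h1 : HasDerivAt (fun τ : ℝ => 2 * (1 + τ)) 2 x := by
      simpa using ((hasDerivAt_id x).const_add 1).const_mul 2
    have h2 : HasDerivAt (fun τ : ℝ => Real.exp (-τ)) (-Real.exp (-x)) x := by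
      simpa using (hasDerivAt_id x).neg.exp
    have h3 : HasDerivAt (fun τ : ℝ => 2 - τ ^ 2) (-(2 * x)) x := by
      simpa using (hasDerivAt_pow 2 x).const_sub 2
    exact ((h1.mul h2).sub h3).congr_deriv (by ring)
  have hmono : MonotoneOn (fun τ : ℝ => 2 * (1 + τ) * Real.exp (-τ) - (2 - τ ^ 2)) (Set.Ici 0) := by
    refine monotoneOn_of_deriv_nonneg (convex_Ici 0)
      (fun x _ => (hd x).continuousAt.continuousWithinAt)
      (fun x _ => (hd x).differentiableAt.differentiableWithinAt) fun x hx => ?_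
    rw [interior_Ici, Set.mem_Ioi] at hx
    rw [(hd x).deriv]
    have : Real.exp (-x) ≤ 1 := Real.exp_le_one_iff.2 (by linarith)
    exact mul_nonneg (by linarith) (by linarith)
  have := hmono (Set.mem_Ici.2 le_rfl) (Set.mem_Ici.2 hτ) hτ
  simp only [add_zero, neg_zero, Real.exp_zero] at this
  linarith

/-- The tangent of the concave function `z ↦ (log z)²` on `[e, ∞)`, in logarithmic coordinates. -/
lemma sq_le_tangent {v L : ℝ} (hv : 1 ≤ v) (hL : 1 ≤ L) :
    v ^ 2 ≤ L ^ 2 + 2 * L * (Real.exp (v - L) - 1) := by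
  rcases le_total L v with h | h
  · have h1 := Real.quadratic_le_exp_of_nonneg (sub_nonneg.2 h)
    have h2 : 2 * L * (1 + (v - L) + (v - L) ^ 2 / 2 - 1) ≤ 2 * L * (Real.exp (v - L) - 1) :=
      mul_le_mul_of_nonneg_left (by linarith) (by linarith)
    nlinarith [mul_nonneg (sub_nonneg.2 hL) (sq_nonneg (v - L))]
  · have h1 := two_sub_sq_le (sub_nonneg.2 h)
    rw [neg_sub] at h1
    have h2 : 1 + (v - L) ≤ Real.exp (v - L) := by linarith [Real.add_one_le_exp (v - L)]
    -- With `L - v` held fixed, the right side minus the left is affine in `v` with slope `2(exp(v -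
    -- L) - 1 - (v - L)) ≥ 0`, so `v = 1` is the worst case, and that is `h1`.
    nlinarith [mul_nonneg (sub_nonneg.2 hv) (sub_nonneg.2 h2)]

end Entropy

end QuantizedEstimation

namespace QuantizedEstimation

/-! ### Fisher information of the transcript, node by node. -/

section Information

variable {X : Type*} [MeasurableSpace X] {d n k : ℕ} {P : Measure X}
  {c : Protocol X n k} {w : c.Transcript → Fin n → X → ℝ}

/-- The conditional expectation of the score given the message with conditional probabilities
`w`. -/
noncomputable def condScore (P : Measure X) (S : X → Param d) (w : X → ℝ) (l : Fin d) : ℝ :=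
  (∫ x, w x * S x l ∂P) / ∫ x, w x ∂P

lemma sum_condScore_sq_eq (S : X → Param d) (u : X → ℝ) :
    ∑ l, condScore P S u l ^ 2 = (∑ l, (∫ x, u x * S x l ∂P) ^ 2) / (∫ x, u x ∂P) ^ 2 := by
  simp only [condScore, div_pow, Finset.sum_div]

namespace IsFactorization

lemma integral_nonneg (hw : IsFactorization c w) (y : c.Transcript) (i : Fin n) :
    0 ≤ ∫ x, w y i x ∂P :=
  MeasureTheory.integral_nonneg (hw.nonneg y i)

lemma prod_nonneg (hw : IsFactorization c w) (y : c.Transcript) :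
    0 ≤ ∏ i, ∫ x, w y i x ∂P :=
  Finset.prod_nonneg fun i _ => hw.integral_nonneg y i

end IsFactorization

variable [IsProbabilityMeasure P]

lemma integral_mul_condScore {u : X → ℝ} (hu : Measurable u) (hu0 : ∀ x, 0 ≤ u x)
    (hu1 : ∀ x, u x ≤ 1) (S : X → Param d) (l : Fin d) :
    (∫ x, u x ∂P) * condScore P S u l = ∫ x, u x * S x l ∂P := by
  by_cases h : ∫ x, u x ∂P = 0
  · rw [integral_weight_mul_eq_zero hu hu0 hu1 h, h, zero_mul]
  · exact mul_div_cancel₀ _ h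

namespace IsFactorization

lemma prob_eq (hw : IsFactorization c w) (y : c.Transcript) :
    c.prob P y = ∏ i, ∫ x, w y i x ∂P := by
  simp only [Protocol.prob, hw.condProb_eq]
  exact integral_fintype_prod_eq_prod fun i => w y i

/-- Fubini on the product space turns the left side into `E[∏ h_i(X_i) ∑_y ∏ w_i(X_i)]`, and the
inner sum is one. Suitable choices of `h` give the total mass and the vanishing of the cross terms.
-/
lemma sum_prod_integral_mul (hw : IsFactorization c w) {h : Fin n → X → ℝ}
    (hh : ∀ i, Integrable (h i) P) :
    ∑ y, ∏ i, ∫ x, w y i x * h i x ∂P = ∏ i, ∫ x, h i x ∂P := by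
  have h1 : ∀ y, ∏ i, ∫ x, w y i x * h i x ∂P =
      ∫ x, ∏ i, w y i (x i) * h i (x i) ∂(Measure.pi fun _ : Fin n => P) := fun y =>
    (integral_fintype_prod_eq_prod fun i x => w y i x * h i x).symm
  simp only [h1]
  rw [← integral_finsetSum, ← integral_fintype_prod_eq_prod]
  · refine integral_congr_ae (ae_of_all _ fun x => ?_)
    simp only [Finset.prod_mul_distrib]
    rw [← Finset.sum_mul, hw.sum_prod, one_mul]
  · intro y _
    exact Integrable.fintype_prod fun i =>
      integrable_weight_mul (hw.measurable y i) (hw.nonneg y i) (hw.le_one y i) (hh i)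

lemma sum_prob (hw : IsFactorization c w) : ∑ y, ∏ i, ∫ x, w y i x ∂P = 1 := by
  simpa using hw.sum_prod_integral_mul (P := P) (h := fun _ _ => 1) fun _ => integrable_const 1

/-- Integrate `sum_prod_erase` over independent samples, with the weight of node `i` set to `1`.
Read as an expectation over transcripts, it bounds the mean of `1 / q_i` by `2^k`. -/
lemma sum_prod_erase_integral (hw : IsFactorization c w) (i : Fin n) :
    ∑ y, ∏ j ∈ Finset.univ.erase i, ∫ x, w y j x ∂P = 2 ^ k := by
  have h0 : ∀ g : Fin n → ℝ,
      ∏ j ∈ Finset.univ.erase i, g j = ∏ j, if j = i then 1 else g j := fun g => by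
    rw [← Finset.mul_prod_erase _ (fun j => if j = i then 1 else g j) (Finset.mem_univ i),
      if_pos rfl, one_mul]
    exact Finset.prod_congr rfl fun j hj => (if_neg (Finset.ne_of_mem_erase hj)).symm
  let u : c.Transcript → Fin n → X → ℝ := fun y j x => if j = i then 1 else w y j x
  have hui : ∀ y j, Integrable (u y j) P := fun y j => by
    by_cases h : j = i
    · simp [u, h]
    · simpa [u, h] using! integrable_weight (hw.measurable y j) (hw.nonneg y j) (hw.le_one y j)
  have h1 : ∀ y, ∏ j ∈ Finset.univ.erase i, ∫ x, w y j x ∂P =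
      ∫ x, ∏ j, u y j (x j) ∂(Measure.pi fun _ : Fin n => P) := fun y => by
    rw [integral_fintype_prod_eq_prod fun j => u y j, h0]
    refine Finset.prod_congr rfl fun j _ => ?_
    by_cases h : j = i <;> simp [u, h]
  simp only [h1]
  rw [← integral_finsetSum _ fun y _ => Integrable.fintype_prod fun j => hui y j]
  have h2 : ∀ x : Fin n → X, ∑ y, ∏ j, u y j (x j) = 2 ^ k := fun x => by
    rw [← hw.sum_prod_erase i x]
    exact Finset.sum_congr rfl fun y _ => (h0 fun j => w y j (x j)).symm
  simp [h2]

/-- The contributions of different nodes to the score of the transcript are uncorrelated. -/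
lemma sum_condScore_mul_condScore_eq_zero (hw : IsFactorization c w) {S : X → Param d} {l : Fin d}
    (hS : Integrable (fun x => S x l) P) (hS0 : ∫ x, S x l ∂P = 0) {i j : Fin n} (hij : i ≠ j) :
    ∑ y, (∏ m, ∫ x, w y m x ∂P) * (condScore P S (w y i) l * condScore P S (w y j) l) = 0 := by
  -- Insert the score at the two nodes `i` and `j` only. The right side of `sum_prod_integral_mul`
  -- then contains the factor `E[S_l] = 0`.
  let h : Fin n → X → ℝ := fun m x => if m = i ∨ m = j then S x l else 1
  have hh : ∀ m, Integrable (h m) P := fun m => by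
    by_cases hm : m = i ∨ m = j
    · simpa [h, hm] using hS
    · simp [h, hm]
  have key := hw.sum_prod_integral_mul hh
  rw [Finset.prod_eq_zero (Finset.mem_univ i) (by simpa [h] using hS0)] at key
  rw [← key]
  refine Finset.sum_congr rfl fun y _ => ?_
  have h1 : ∀ m, ∫ x, w y m x * h m x ∂P = (∫ x, w y m x ∂P) *
      ((if m = i then condScore P S (w y i) l else 1) *
        if m = j then condScore P S (w y j) l else 1) := by
    intro m
    have hc := fun m => integral_mul_condScore (P := P) (hw.measurable y m) (hw.nonneg y m)
      (hw.le_one y m) S l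
    by_cases hi : m = i
    · subst hi
      simp [h, hij, hc]
    · by_cases hj : m = j
      · subst hj
        simp [h, hi, hc]
      · simp [h, hi, hj]
  simp only [h1, Finset.prod_mul_distrib, Finset.prod_ite_eq', Finset.mem_univ, if_true]

/-- The Fisher information of a transcript is the sum of the contributions of the nodes. -/
lemma sum_sq_sum_condScore_eq (hw : IsFactorization c w) {S : X → Param d}
    (hS : ∀ l, Integrable (fun x => S x l) P) (hS0 : ∀ l, ∫ x, S x l ∂P = 0) :
    ∑ y, (∏ m, ∫ x, w y m x ∂P) * ∑ l, (∑ i, condScore P S (w y i) l) ^ 2 =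
      ∑ i, ∑ y, (∏ m, ∫ x, w y m x ∂P) * ∑ l, condScore P S (w y i) l ^ 2 := by
  calc ∑ y, (∏ m, ∫ x, w y m x ∂P) * ∑ l, (∑ i, condScore P S (w y i) l) ^ 2
      = ∑ y, ∑ l, ∑ i, ∑ j, (∏ m, ∫ x, w y m x ∂P) *
          (condScore P S (w y i) l * condScore P S (w y j) l) := by
        simp only [sq, Finset.sum_mul_sum]
        simp only [Finset.mul_sum]
    _ = ∑ l, ∑ i, ∑ j, ∑ y, (∏ m, ∫ x, w y m x ∂P) *
          (condScore P S (w y i) l * condScore P S (w y j) l) := by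
        rw [Finset.sum_comm]
        refine Finset.sum_congr rfl fun l _ => ?_
        rw [Finset.sum_comm]
        refine Finset.sum_congr rfl fun i _ => ?_
        rw [Finset.sum_comm]
    _ = ∑ l, ∑ i, ∑ y, (∏ m, ∫ x, w y m x ∂P) *
          (condScore P S (w y i) l * condScore P S (w y i) l) := by
        refine Finset.sum_congr rfl fun l _ => Finset.sum_congr rfl fun i _ => ?_
        refine Finset.sum_eq_single i (fun j _ hj => ?_) (by simp)
        exact hw.sum_condScore_mul_condScore_eq_zero (hS l) (hS0 l) hj.symm
    _ = _ := by
        rw [Finset.sum_comm]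
        refine Finset.sum_congr rfl fun i _ => ?_
        rw [Finset.sum_comm]
        simp only [sq, Finset.mul_sum]

/-- Contribution of one node under a variance bound on the score. -/
lemma node_information_le_of_variance (hw : IsFactorization c w) {S : X → Param d}
    (hS : ∀ l, MemLp (fun x => S x l) 2 P) (hS0 : ∀ l, ∫ x, S x l ∂P = 0) {I₀ : ℝ} (hI₀ : 0 ≤ I₀)
    (hvar : ∀ u : Param d, ‖u‖ = 1 → variance (fun x => inner ℝ u (S x)) P ≤ I₀) (i : Fin n) :
    ∑ y, (∏ m, ∫ x, w y m x ∂P) * ∑ l, condScore P S (w y i) l ^ 2 ≤ I₀ * 2 ^ k := by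
  rw [← hw.sum_prod_erase_integral (P := P) i, Finset.mul_sum]
  refine Finset.sum_le_sum fun y _ => ?_
  have hr : 0 ≤ ∏ j ∈ Finset.univ.erase i, ∫ x, w y j x ∂P :=
    Finset.prod_nonneg fun j _ => hw.integral_nonneg y j
  rw [← Finset.mul_prod_erase _ _ (Finset.mem_univ i), mul_right_comm]
  -- The product over the other nodes is split off and sums to `2^k`; what remains for node `i` is
  -- `‖E[w S]‖² / q ≤ I₀`.
  refine mul_le_mul_of_nonneg_right ?_ hr
  have hq := hw.integral_nonneg (P := P) y i
  have hG := sum_sq_integral_weight_mul_le (P := P) (hw.measurable y i) (hw.nonneg y i)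
    (hw.le_one y i) hS (mul_nonneg hq hI₀) fun u hu => by
      refine (sq_integral_weight_mul_le (hw.measurable y i) (hw.nonneg y i) (hw.le_one y i)
        (memLp_inner hS u)).trans (mul_le_mul_of_nonneg_left ?_ hq)
      have h0 : ∫ x, inner ℝ u (S x) ∂P = 0 := by
        have := integral_weight_mul_inner (P := P) (w := fun _ => 1) measurable_const
          (fun _ => zero_le_one) (fun _ => le_rfl) hS u
        simpa [hS0] using this
      rw [← variance_of_integral_eq_zero (memLp_inner hS u).1.aemeasurable h0]
      exact hvar u hu
  rw [sum_condScore_sq_eq]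
  rcases hq.eq_or_lt with h | h
  · simpa [← h] using hI₀
  · rw [mul_div_assoc', div_le_iff₀ (by positivity)]
    nlinarith

/-- Jensen for the concave function `(log z)²` on `[e, ∞)` at `z = e / q_i`, whose mean is at most
`e 2^k`; `L` is the logarithm of this bound. The tangent at `e^L` is affine in `1 / q_i`, so it can
be summed exactly. -/
lemma sum_prob_mul_sq_log_le (hw : IsFactorization c w) (i : Fin n) :
    ∑ y, (∏ m, ∫ x, w y m x ∂P) * (1 - Real.log (∫ x, w y i x ∂P)) ^ 2 ≤
      (1 + k * Real.log 2) ^ 2 := by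
  set L : ℝ := 1 + k * Real.log 2 with hL
  have hL1 : 1 ≤ L := by
    have := Real.log_nonneg (one_le_two (α := ℝ))
    have : 0 ≤ k * Real.log 2 := by positivity
    linarith
  have key : ∀ y, (∏ m, ∫ x, w y m x ∂P) * (1 - Real.log (∫ x, w y i x ∂P)) ^ 2 ≤
      (L ^ 2 - 2 * L) * (∏ m, ∫ x, w y m x ∂P) +
        2 * L / 2 ^ k * ∏ j ∈ Finset.univ.erase i, ∫ x, w y j x ∂P := by
    intro y
    have hr : 0 ≤ ∏ j ∈ Finset.univ.erase i, ∫ x, w y j x ∂P :=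
      Finset.prod_nonneg fun j _ => hw.integral_nonneg y j
    rw [← Finset.mul_prod_erase _ _ (Finset.mem_univ i)]
    set r := ∏ j ∈ Finset.univ.erase i, ∫ x, w y j x ∂P
    have hq := hw.integral_nonneg (P := P) y i
    have hq1 := integral_weight_le_one (P := P) (hw.measurable y i) (hw.nonneg y i) (hw.le_one y i)
    set q := ∫ x, w y i x ∂P
    rcases hq.eq_or_lt with h | h
    · rw [← h]
      simp only [zero_mul, mul_zero, zero_add]
      positivity
    · have hv1 : 1 ≤ 1 - Real.log q := by linarith [Real.log_nonpos hq hq1]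
      have h1 := mul_le_mul_of_nonneg_left (sq_le_tangent hv1 hL1) (mul_nonneg hq hr)
      have h2 : Real.exp (1 - Real.log q - L) = 1 / (q * 2 ^ k) := by
        have : 1 - Real.log q - L = -(Real.log q + k * Real.log 2) := by
          rw [hL]
          ring
        rw [this, Real.exp_neg, Real.exp_add, Real.exp_log h, Real.exp_nat_mul,
          Real.exp_log two_pos, one_div]
      rw [h2] at h1
      refine h1.trans (le_of_eq ?_)
      field_simp
      ring
  refine (Finset.sum_le_sum fun y _ => key y).trans (le_of_eq ?_)
  rw [Finset.sum_add_distrib, ← Finset.mul_sum, ← Finset.mul_sum, hw.sum_prob,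
    hw.sum_prod_erase_integral]
  field_simp
  ring

/-- By the power mean inequality with exponent `p`, the mean of `v^(2/p)` is at most the `1/p`-th
power of the mean of `v²`. Since `1 + k log 2 ≤ 2k` for `k ≥ 1`, this is at most `(2k)^(2/p)`, and
`2^(2/p) ≤ 4`. -/
lemma sum_prob_mul_rpow_log_le (hw : IsFactorization c w) (hk : k ≠ 0) {p : ℝ} (hp : 1 ≤ p)
    (i : Fin n) :
    ∑ y, (∏ m, ∫ x, w y m x ∂P) * (1 - Real.log (∫ x, w y i x ∂P)) ^ (2 / p) ≤
      4 * (k : ℝ) ^ (2 / p) := by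
  have hv : ∀ y, 1 ≤ 1 - Real.log (∫ x, w y i x ∂P) := fun y => by
    have := Real.log_nonpos (hw.integral_nonneg y i)
      (integral_weight_le_one (P := P) (hw.measurable y i) (hw.nonneg y i) (hw.le_one y i))
    linarith
  have hp0 : 0 < p := by linarith
  have h1 := Real.arith_mean_le_rpow_mean Finset.univ (fun y => ∏ m, ∫ x, w y m x ∂P)
    (fun y => (1 - Real.log (∫ x, w y i x ∂P)) ^ (2 / p)) (fun y _ => hw.prod_nonneg y)
    hw.sum_prob (fun y _ => Real.rpow_nonneg (by linarith [hv y]) _) hp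
  have h2 : ∀ y, ((1 - Real.log (∫ x, w y i x ∂P)) ^ (2 / p)) ^ p =
      (1 - Real.log (∫ x, w y i x ∂P)) ^ 2 := fun y => by
    rw [← Real.rpow_mul (by linarith [hv y]), div_mul_cancel₀ _ hp0.ne']
    exact Real.rpow_natCast _ 2
  simp only [h2] at h1
  have hk1 : (1 : ℝ) ≤ k := by exact_mod_cast Nat.one_le_iff_ne_zero.2 hk
  have hlog : 0 ≤ Real.log 2 := Real.log_nonneg one_le_two
  have hlog1 : Real.log 2 ≤ 1 := by linarith [Real.log_two_lt_d9]
  have hL : 1 + k * Real.log 2 ≤ 2 * k := by nlinarith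
  refine h1.trans ?_
  calc (∑ y, (∏ m, ∫ x, w y m x ∂P) * (1 - Real.log (∫ x, w y i x ∂P)) ^ 2) ^ (1 / p)
      ≤ ((2 * (k : ℝ)) ^ 2) ^ (1 / p) := by
        refine Real.rpow_le_rpow (Finset.sum_nonneg fun y _ =>
          mul_nonneg (hw.prod_nonneg y) (sq_nonneg _)) ?_ (by positivity)
        exact (hw.sum_prob_mul_sq_log_le i).trans (pow_le_pow_left₀ (by positivity) hL 2)
    _ = 2 ^ (2 / p) * (k : ℝ) ^ (2 / p) := by
        rw [← Real.rpow_natCast, ← Real.rpow_mul (by positivity), Real.mul_rpow (by norm_num)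
          (by positivity)]
        simp [div_eq_mul_inv]
    _ ≤ 4 * (k : ℝ) ^ (2 / p) := by
        refine mul_le_mul_of_nonneg_right ?_ (by positivity)
        calc (2 : ℝ) ^ (2 / p) ≤ 2 ^ (2 : ℝ) := by
              refine Real.rpow_le_rpow_of_exponent_le one_le_two ?_
              exact div_le_self zero_le_two hp
          _ = 4 := by norm_num

/-- Contribution of one node under an Orlicz norm bound on the score. -/
lemma node_information_le_of_orliczNorm (hw : IsFactorization c w) {S : X → Param d}
    (hS : ∀ l, MemLp (fun x => S x l) 2 P) (hS0 : ∀ l, ∫ x, S x l ∂P = 0) {I₀ p : ℝ}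
    (hI₀ : 0 ≤ I₀) (hp : 1 ≤ p)
    (horl : ∀ u : Param d, ‖u‖ = 1 →
      orliczNorm p (fun x => inner ℝ u (S x)) P ^ 2 ≤ ENNReal.ofReal I₀) (i : Fin n) :
    ∑ y, (∏ m, ∫ x, w y m x ∂P) * ∑ l, condScore P S (w y i) l ^ 2 ≤
      4 * I₀ * (k : ℝ) ^ (2 / p) := by
  -- Without communication the bound `1 + k log 2 ≤ 2k` fails, but then all weights are `1` and the
  -- conditional score is the mean of the score, which is zero.
  by_cases hk : k = 0
  · have : ∀ y l, condScore P S (w y i) l = 0 := fun y l => by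
      simp [condScore, hw.eq_one hk, hS0]
    simp only [this]
    simp only [ne_eq, OfNat.ofNat_ne_zero, not_false_eq_true, zero_pow, Finset.sum_const_zero,
      mul_zero]
    positivity
  have h1 := mul_le_mul_of_nonneg_left (hw.sum_prob_mul_rpow_log_le (P := P) hk hp i) hI₀
  rw [Finset.mul_sum] at h1
  refine (Finset.sum_le_sum fun y _ => ?_).trans (h1.trans (le_of_eq (by ring)))
  rw [mul_left_comm]
  refine mul_le_mul_of_nonneg_left ?_ (hw.prod_nonneg y)
  have hq := hw.integral_nonneg (P := P) y i
  have hv : 0 ≤ 1 - Real.log (∫ x, w y i x ∂P) := by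
    linarith [Real.log_nonpos hq
      (integral_weight_le_one (P := P) (hw.measurable y i) (hw.nonneg y i) (hw.le_one y i))]
  have hG := sum_sq_integral_weight_mul_le (P := P) (hw.measurable y i) (hw.nonneg y i)
    (hw.le_one y i) hS (C := (∫ x, w y i x ∂P) ^ 2 *
      (I₀ * (1 - Real.log (∫ x, w y i x ∂P)) ^ (2 / p))) (by positivity) fun u hu =>
      sq_integral_weight_mul_le_of_orliczNorm (hw.measurable y i) (hw.nonneg y i) (hw.le_one y i)
        hp hI₀ ((memLp_inner hS u).integrable one_le_two) (horl u hu)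
  rw [sum_condScore_sq_eq]
  exact div_le_of_le_mul₀ (sq_nonneg _) (by positivity) (hG.trans_eq (mul_comm _ _))

end IsFactorization

end Information

end QuantizedEstimation

namespace QuantizedEstimation

open Set Filter Topology

/-! ### The cosine-squared prior and integration by parts on the cube. -/

section VanTrees

variable {d : ℕ} {b : ℝ}

/-- A function on `ℝ^d` that is continuous in each coordinate separately is measurable. -/
lemma measurable_of_continuous_update {d : ℕ} {F : (Fin d → ℝ) → ℝ}
    (hF : ∀ θ i, Continuous fun t => F (Function.update θ i t)) : Measurable F := by
  induction d with
  | zero => exact measurable_of_countable F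
  | succ d ih =>
    let u : ℝ → (Fin d → ℝ) → ℝ := fun t θ => F (Fin.cons t θ)
    have hu : Measurable (Function.uncurry u) := by
      refine measurable_uncurry_of_continuous_of_measurable (fun θ => ?_) fun t => ih fun θ i => ?_
      · simpa [u] using! hF (Fin.cons 0 θ) 0
      · simpa [u, Fin.cons_update] using! hF (Fin.cons t θ) i.succ
    have h2 : F = Function.uncurry u ∘ fun θ => (θ 0, fun i : Fin d => θ i.succ) := by
      funext θ
      simp only [Function.comp, Function.uncurry, u]
      congr 1
      exact (Fin.cons_self_tail θ).symm
    rw [h2]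
    exact hu.comp ((measurable_pi_apply 0).prodMk
      (measurable_pi_lambda _ fun i => measurable_pi_apply _))

/-- Lebesgue measure on the open cube. -/
noncomputable def cubeMeasure (d : ℕ) (b : ℝ) : Measure (Fin d → ℝ) :=
  Measure.pi fun _ => volume.restrict (Ioo (-b) b)

instance : IsFiniteMeasure (cubeMeasure d b) := by
  unfold cubeMeasure
  infer_instance

lemma ae_mem_cube : ∀ᵐ θ ∂(cubeMeasure d b), ∀ i, θ i ∈ Ioo (-b) b := by
  rw [ae_all_iff]
  intro i
  exact (Measure.quasiMeasurePreserving_eval _ i).ae (ae_restrict_mem measurableSet_Ioo)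

/-- Two functions with the same integrals along all lines in a coordinate direction have the same
integral over the cube. -/
lemma integral_cubeMeasure_congr {F G : (Fin d → ℝ) → ℝ} (hF : Integrable F (cubeMeasure d b))
    (hG : Integrable G (cubeMeasure d b)) (hb : 0 < b) (i : Fin d)
    (h : ∀ θ : Fin d → ℝ, (∀ j, θ j ∈ Ioo (-b) b) →
      ∫ t in Ioo (-b) b, F (Function.update θ i t) = ∫ t in Ioo (-b) b, G (Function.update θ i t)) :
    ∫ θ, F θ ∂(cubeMeasure d b) = ∫ θ, G θ ∂(cubeMeasure d b) := by
  cases d with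
  | zero => exact i.elim0
  | succ d =>
    have hmp := (measurePreserving_piFinSuccAbove
      (fun _ : Fin (d + 1) => volume.restrict (Ioo (-b) b)) i).symm
    have key : ∀ H : (Fin (d + 1) → ℝ) → ℝ, Integrable H (cubeMeasure (d + 1) b) →
        ∫ θ, H θ ∂(cubeMeasure (d + 1) b) =
          ∫ η, (∫ t in Ioo (-b) b, H (i.insertNth t η)) ∂(cubeMeasure d b) := by
      intro H hH
      have h1 := hmp.integral_comp' H
      have h2 := hmp.integrable_comp_of_integrable hH
      rw [cubeMeasure, ← h1]
      exact integral_prod_symm _ h2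
    rw [key F hF, key G hG]
    refine integral_congr_ae ?_
    filter_upwards [ae_mem_cube] with η hη
    -- The value `0` only supplies a point of the cube; the update in coordinate `i` overwrites it.
    have h3 := h (i.insertNth 0 η) fun j => by
      refine Fin.succAboveCases i ?_ (fun j => ?_) j
      · simpa using hb
      · simpa using hη j
    simpa using h3

/-- The square root of the cosine-squared prior. -/
noncomputable def cosProd (b : ℝ) (θ : Fin d → ℝ) : ℝ := ∏ j, Real.cos (Real.pi * θ j / (2 * b))

/-- The partial derivative of `cosProd` in direction `i`. -/
noncomputable def cosProdDeriv (b : ℝ) (i : Fin d) (θ : Fin d → ℝ) : ℝ :=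
  -(Real.pi / (2 * b)) * Real.sin (Real.pi * θ i / (2 * b)) *
    ∏ j ∈ Finset.univ.erase i, Real.cos (Real.pi * θ j / (2 * b))

lemma continuous_cosProd : Continuous (cosProd b : (Fin d → ℝ) → ℝ) := by
  unfold cosProd
  fun_prop

lemma continuous_cosProdDeriv (i : Fin d) : Continuous (cosProdDeriv b i) := by
  unfold cosProdDeriv
  fun_prop

lemma cosProd_eq_mul (i : Fin d) (θ : Fin d → ℝ) :
    cosProd b θ = Real.cos (Real.pi * θ i / (2 * b)) *
      ∏ j ∈ Finset.univ.erase i, Real.cos (Real.pi * θ j / (2 * b)) :=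
  (Finset.mul_prod_erase _ _ (Finset.mem_univ i)).symm

lemma prod_erase_update (i : Fin d) (θ : Fin d → ℝ) (t : ℝ) (φ : ℝ → ℝ) :
    ∏ j ∈ Finset.univ.erase i, φ (Function.update θ i t j) =
      ∏ j ∈ Finset.univ.erase i, φ (θ j) :=
  Finset.prod_congr rfl fun j hj => by
    rw [Function.update_of_ne (Finset.ne_of_mem_erase hj)]

lemma hasDerivAt_cosProd (i : Fin d) (θ : Fin d → ℝ) (t : ℝ) :
    HasDerivAt (fun t => cosProd b (Function.update θ i t))
      (cosProdDeriv b i (Function.update θ i t)) t := by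
  have h1 : HasDerivAt (fun t : ℝ => Real.cos (Real.pi * t / (2 * b)))
      (-(Real.pi / (2 * b)) * Real.sin (Real.pi * t / (2 * b))) t := by
    have h := (((hasDerivAt_id t).const_mul Real.pi).div_const (2 * b)).cos
    exact h.congr_deriv (by simp; ring)
  simp only [cosProd_eq_mul i, cosProdDeriv, Function.update_self,
    prod_erase_update i θ _ (fun r => Real.cos (Real.pi * r / (2 * b)))]
  exact h1.mul_const _

/-- The prior vanishes on the faces of the cube, which removes the boundary terms in the integration
by parts. -/
lemma cosProd_update_endpoint (hb : 0 < b) (i : Fin d) (θ : Fin d → ℝ) {t : ℝ}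
    (ht : t = b ∨ t = -b) : cosProd b (Function.update θ i t) = 0 := by
  have h : Real.cos (Real.pi * t / (2 * b)) = 0 := by
    rcases ht with rfl | rfl
    · rw [show Real.pi * t / (2 * t) = Real.pi / 2 by field_simp, Real.cos_pi_div_two]
    · rw [show Real.pi * -b / (2 * b) = -(Real.pi / 2) by field_simp, Real.cos_neg,
        Real.cos_pi_div_two]
  rw [cosProd_eq_mul i, Function.update_self, h, zero_mul]

lemma setIntegral_cos_sq (hb : 0 < b) :
    ∫ t in Ioo (-b) b, Real.cos (Real.pi * t / (2 * b)) ^ 2 = b := by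
  have hc : Real.pi / (2 * b) ≠ 0 := by positivity
  rw [← integral_Ioc_eq_integral_Ioo, ← intervalIntegral.integral_of_le (by linarith)]
  have := intervalIntegral.integral_comp_mul_left (fun u => Real.cos u ^ 2) hc (a := -b) (b := b)
  simp only [mul_div_right_comm] at this ⊢
  rw [this, integral_cos_sq, show Real.pi / (2 * b) * b = Real.pi / 2 by field_simp,
    show Real.pi / (2 * b) * -b = -(Real.pi / 2) by field_simp]
  simp
  field_simp

lemma setIntegral_sin_sq (hb : 0 < b) :
    ∫ t in Ioo (-b) b, Real.sin (Real.pi * t / (2 * b)) ^ 2 = b := by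
  have hc : Real.pi / (2 * b) ≠ 0 := by positivity
  rw [← integral_Ioc_eq_integral_Ioo, ← intervalIntegral.integral_of_le (by linarith)]
  have := intervalIntegral.integral_comp_mul_left (fun u => Real.sin u ^ 2) hc (a := -b) (b := b)
  simp only [mul_div_right_comm] at this ⊢
  rw [this, integral_sin_sq, show Real.pi / (2 * b) * b = Real.pi / 2 by field_simp,
    show Real.pi / (2 * b) * -b = -(Real.pi / 2) by field_simp]
  simp
  field_simp

lemma integral_cosProd_sq (hb : 0 < b) : ∫ θ, cosProd b θ ^ 2 ∂(cubeMeasure d b) = b ^ d := by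
  simp only [cosProd, ← Finset.prod_pow]
  rw [cubeMeasure, integral_fintype_prod_eq_prod fun (_ : Fin d) t =>
    Real.cos (Real.pi * t / (2 * b)) ^ 2]
  simp [setIntegral_cos_sq hb]

/-- Relative to the mass `b^d` of `cosProd²`, four times this integral is `π² / b²`, the information
of the prior in one coordinate. -/
lemma integral_cosProdDeriv_sq (hb : 0 < b) (i : Fin d) :
    ∫ θ, cosProdDeriv b i θ ^ 2 ∂(cubeMeasure d b) = (Real.pi / (2 * b)) ^ 2 * b ^ d := by
  have h : ∀ θ : Fin d → ℝ, cosProdDeriv b i θ ^ 2 = (Real.pi / (2 * b)) ^ 2 *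
      ∏ j, if j = i then Real.sin (Real.pi * θ j / (2 * b)) ^ 2
        else Real.cos (Real.pi * θ j / (2 * b)) ^ 2 := by
    intro θ
    rw [← Finset.mul_prod_erase _ _ (Finset.mem_univ i), if_pos rfl, cosProdDeriv,
      Finset.prod_congr rfl (g := fun j => Real.cos (Real.pi * θ j / (2 * b)) ^ 2)
      fun j hj => if_neg (Finset.ne_of_mem_erase hj), Finset.prod_pow]
    ring
  simp only [h]
  rw [integral_const_mul, cubeMeasure, integral_fintype_prod_eq_prod fun (j : Fin d) t =>
    if j = i then Real.sin (Real.pi * t / (2 * b)) ^ 2 else Real.cos (Real.pi * t / (2 * b)) ^ 2]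
  congr 1
  have : ∀ j, (∫ t in Ioo (-b) b, if j = i then Real.sin (Real.pi * t / (2 * b)) ^ 2
      else Real.cos (Real.pi * t / (2 * b)) ^ 2) = b := fun j => by
    split_ifs
    · exact setIntegral_sin_sq hb
    · exact setIntegral_cos_sq hb
  simp [this]

lemma abs_cosProd_le_one (θ : Fin d → ℝ) : |cosProd b θ| ≤ 1 := by
  rw [cosProd, Finset.abs_prod]
  exact Finset.prod_le_one (fun _ _ => abs_nonneg _) fun _ _ => Real.abs_cos_le_one _

lemma abs_cosProdDeriv_le (hb : 0 < b) (i : Fin d) (θ : Fin d → ℝ) :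
    |cosProdDeriv b i θ| ≤ Real.pi / (2 * b) := by
  have hp : 0 ≤ Real.pi / (2 * b) := by positivity
  rw [cosProdDeriv, abs_mul, abs_mul, abs_neg, abs_of_nonneg hp, Finset.abs_prod, mul_assoc]
  refine mul_le_of_le_one_right hp (mul_le_one₀ (Real.abs_sin_le_one _)
    (Finset.prod_nonneg fun _ _ => abs_nonneg _) ?_)
  exact Finset.prod_le_one (fun _ _ => abs_nonneg _) fun _ _ => Real.abs_cos_le_one _

/-- Bounded almost everywhere measurable functions on the cube are integrable. -/
lemma integrable_cubeMeasure_of_bound {F : (Fin d → ℝ) → ℝ}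
    (hF : AEStronglyMeasurable F (cubeMeasure d b)) (C : ℝ)
    (h : ∀ θ : Fin d → ℝ, (∀ j, θ j ∈ Ioo (-b) b) → |F θ| ≤ C) :
    Integrable F (cubeMeasure d b) :=
  Integrable.of_bound hF C (ae_mem_cube.mono fun θ hθ => h θ hθ)

section Partial

variable {p : (Fin d → ℝ) → ℝ} {g : (Fin d → ℝ) → ℝ}

/-- Extension of a function from the closed cube to the whole space. -/
lemma measurable_comp_clamp (hb : 0 < b)
    (hp : ∀ θ : Fin d → ℝ, (∀ j, θ j ∈ Icc (-b) b) → ∀ i,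
      ContinuousAt (fun t => p (Function.update θ i t)) (θ i)) :
    Measurable fun θ : Fin d → ℝ => p fun j => max (-b) (min (θ j) b) := by
  have hcl : ∀ r : ℝ, max (-b) (min r b) ∈ Icc (-b) b := fun r =>
    ⟨le_max_left _ _, max_le (by linarith) (min_le_right _ _)⟩
  refine measurable_of_continuous_update fun θ i => ?_
  have h1 : (fun t => p fun j => max (-b) (min (Function.update θ i t j) b)) =
      (fun t => p (Function.update (fun j => max (-b) (min (θ j) b)) i t)) ∘
        fun t => max (-b) (min t b) := by
    funext t
    simp only [Function.comp]
    congr 1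
    funext j
    by_cases h : j = i
    · subst h
      simp
    · simp [h]
  rw [h1]
  refine ContinuousOn.comp_continuous (s := Icc (-b) b) (fun t ht => ?_) (by fun_prop) hcl
  have := hp (Function.update (fun j => max (-b) (min (θ j) b)) i t) (fun j => by
    by_cases h : j = i
    · subst h
      simpa using ht
    · simpa [h] using hcl (θ j)) i
  simpa using this.continuousWithinAt

lemma clamp_eq {θ : Fin d → ℝ} (hθ : ∀ j, θ j ∈ Icc (-b) b) :
    (fun j => max (-b) (min (θ j) b)) = θ := by
  funext j
  rw [min_eq_left (hθ j).2, max_eq_right (hθ j).1]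

lemma aemeasurable_cubeMeasure (hb : 0 < b)
    (hp : ∀ θ : Fin d → ℝ, (∀ j, θ j ∈ Icc (-b) b) → ∀ i,
      ContinuousAt (fun t => p (Function.update θ i t)) (θ i)) :
    AEMeasurable p (cubeMeasure d b) := by
  refine (measurable_comp_clamp hb hp).aemeasurable.congr ?_
  filter_upwards [ae_mem_cube] with θ hθ
  rw [clamp_eq fun j => Ioo_subset_Icc_self (hθ j)]

/-- The derivative is the limit of forward difference quotients of the clamped extension; at an
interior point the forward step eventually stays inside the cube, where clamping does nothing. -/
lemma aemeasurable_partialDeriv (hb : 0 < b)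
    (hp : ∀ θ : Fin d → ℝ, (∀ j, θ j ∈ Icc (-b) b) → ∀ i,
      ContinuousAt (fun t => p (Function.update θ i t)) (θ i)) {i : Fin d}
    (hg : ∀ θ : Fin d → ℝ, (∀ j, θ j ∈ Icc (-b) b) →
      HasDerivAt (fun t => p (Function.update θ i t)) (g θ) (θ i)) :
    AEMeasurable g (cubeMeasure d b) := by
  have hm := measurable_comp_clamp hb hp
  let ε : ℕ → ℝ := fun n => 1 / ((n : ℝ) + (1 : ℕ))
  have hε0 : ∀ n, 0 < ε n := fun n => by positivity
  have hεt : Tendsto ε atTop (𝓝 0) := tendsto_const_div_add_atTop 1 1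
  refine aemeasurable_of_tendsto_metrizable_ae' (f := fun n θ => (ε n)⁻¹ *
    ((p fun j => max (-b) (min (Function.update θ i (θ i + ε n) j) b)) -
      p fun j => max (-b) (min (θ j) b))) (fun n => ?_) ?_
  · refine Measurable.aemeasurable ?_
    refine ((hm.comp (f := fun θ : Fin d → ℝ => Function.update θ i (θ i + ε n)) ?_).sub
      hm).const_mul _
    refine measurable_pi_lambda _ fun j => ?_
    by_cases h : j = i
    · subst h
      simpa using (measurable_pi_apply j).add_const _
    · simpa [h] using measurable_pi_apply j
  · filter_upwards [ae_mem_cube] with θ hθ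
    have hθ' : ∀ j, θ j ∈ Icc (-b) b := fun j => Ioo_subset_Icc_self (hθ j)
    refine (tendsto_seq_slope (hg θ hθ') hεt fun n => (hε0 n).ne').congr' ?_
    have : ∀ᶠ n in atTop, ε n < b - θ i := hεt.eventually_lt_const (by linarith [(hθ i).2])
    filter_upwards [this] with n hn
    rw [clamp_eq hθ', clamp_eq, Function.update_eq_self]
    intro j
    by_cases h : j = i
    · subst h
      simpa using ⟨by linarith [(hθ j).1, hε0 n], by linarith⟩
    · simpa [h] using hθ' j

/-- Integration by parts in one coordinate against the cosine-squared prior. -/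
lemma integral_by_parts_cosProd (hb : 0 < b) {i : Fin d} {C D : ℝ}
    (hpC : ∀ θ : Fin d → ℝ, (∀ j, θ j ∈ Icc (-b) b) → |p θ| ≤ C)
    (hgD : ∀ θ : Fin d → ℝ, (∀ j, θ j ∈ Icc (-b) b) → |g θ| ≤ D)
    (hpm : AEMeasurable p (cubeMeasure d b)) (hgm : AEMeasurable g (cubeMeasure d b))
    (hg : ∀ θ : Fin d → ℝ, (∀ j, θ j ∈ Icc (-b) b) →
      HasDerivAt (fun t => p (Function.update θ i t)) (g θ) (θ i)) (e : ℝ) :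
    Integrable (fun θ => (e - θ i) * (g θ * cosProd b θ ^ 2 +
        p θ * (2 * cosProd b θ * cosProdDeriv b i θ))) (cubeMeasure d b) ∧
      Integrable (fun θ => p θ * cosProd b θ ^ 2) (cubeMeasure d b) ∧
      ∫ θ, (e - θ i) * (g θ * cosProd b θ ^ 2 +
        p θ * (2 * cosProd b θ * cosProdDeriv b i θ)) ∂(cubeMeasure d b) =
      ∫ θ, p θ * cosProd b θ ^ 2 ∂(cubeMeasure d b) := by
  have hm := (continuous_cosProd (d := d) (b := b)).measurable.aemeasurable (μ := cubeMeasure d b)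
  have hm' := (continuous_cosProdDeriv (b := b) i).measurable.aemeasurable (μ := cubeMeasure d b)
  have hsq : ∀ θ : Fin d → ℝ, |cosProd b θ| ^ 2 ≤ 1 := fun θ =>
    pow_le_one₀ (abs_nonneg _) (abs_cosProd_le_one θ)
  have bound1 : ∀ θ : Fin d → ℝ, (∀ j, θ j ∈ Icc (-b) b) → |p θ * cosProd b θ ^ 2| ≤ C := by
    intro θ hθ
    rw [abs_mul, abs_pow]
    exact (mul_le_of_le_one_right (abs_nonneg _) (hsq θ)).trans (hpC θ hθ)
  have bound2 : ∀ θ : Fin d → ℝ, (∀ j, θ j ∈ Icc (-b) b) →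
      |(e - θ i) * (g θ * cosProd b θ ^ 2 + p θ * (2 * cosProd b θ * cosProdDeriv b i θ))| ≤
        (|e| + b) * (D + C * (2 * 1 * (Real.pi / (2 * b)))) := by
    intro θ hθ
    have hC0 := (abs_nonneg _).trans (hpC θ hθ)
    have hD0 := (abs_nonneg _).trans (hgD θ hθ)
    rw [abs_mul]
    refine mul_le_mul ?_ ?_ (abs_nonneg _) (by positivity)
    · exact (abs_sub _ _).trans (by gcongr; exact abs_le.2 (hθ i))
    · refine (abs_add_le _ _).trans (add_le_add ?_ ?_)
      · rw [abs_mul, abs_pow]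
        exact (mul_le_of_le_one_right (abs_nonneg _) (hsq θ)).trans (hgD θ hθ)
      · rw [abs_mul, abs_mul, abs_mul, abs_two]
        have h1 := abs_cosProd_le_one (b := b) θ
        have h2 := abs_cosProdDeriv_le hb i θ
        have h3 := hpC θ hθ
        gcongr
  have hi1 : Integrable (fun θ => (e - θ i) * (g θ * cosProd b θ ^ 2 +
        p θ * (2 * cosProd b θ * cosProdDeriv b i θ))) (cubeMeasure d b) := by
    refine integrable_cubeMeasure_of_bound (AEMeasurable.aestronglyMeasurable ?_) _
      fun θ hθ => bound2 θ fun j => Ioo_subset_Icc_self (hθ j)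
    have he : AEMeasurable (fun θ : Fin d → ℝ => e - θ i) (cubeMeasure d b) :=
      (measurable_const.sub (measurable_pi_apply i)).aemeasurable
    exact he.mul ((hgm.mul (hm.pow_const 2)).add (hpm.mul ((hm.const_mul 2).mul hm')))
  have hi2 : Integrable (fun θ => p θ * cosProd b θ ^ 2) (cubeMeasure d b) :=
    integrable_cubeMeasure_of_bound (hpm.mul (hm.pow_const 2)).aestronglyMeasurable _
      fun θ hθ => bound1 θ fun j => Ioo_subset_Icc_self (hθ j)
  refine ⟨hi1, hi2, integral_cubeMeasure_congr hi1 hi2 hb i fun θ hθ => ?_⟩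
  have hmem : ∀ t ∈ Icc (-b) b, ∀ j, Function.update θ i t j ∈ Icc (-b) b := fun t ht j => by
    by_cases h : j = i
    · subst h
      simpa using ht
    · simpa [h] using Ioo_subset_Icc_self (hθ j)
  have hpd : ∀ t ∈ Icc (-b) b, HasDerivAt (fun t => p (Function.update θ i t))
      (g (Function.update θ i t)) t := fun t ht => by
    simpa using hg (Function.update θ i t) (hmem t ht)
  set c : ℝ → ℝ := fun t => cosProd b (Function.update θ i t) with hc
  set c' : ℝ → ℝ := fun t => cosProdDeriv b i (Function.update θ i t) with hc'
  set P : ℝ → ℝ := fun t => p (Function.update θ i t) with hP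
  set G : ℝ → ℝ := fun t => g (Function.update θ i t) with hG
  have hcd : ∀ t, HasDerivAt c (c' t) t := hasDerivAt_cosProd i θ
  have hcc : Continuous c := continuous_iff_continuousAt.2 fun t => (hcd t).continuousAt
  have hupd : Continuous fun t : ℝ => Function.update θ i t := by fun_prop
  have hc'c : Continuous c' := (continuous_cosProdDeriv i).comp hupd
  have hPc : ContinuousOn P (Icc (-b) b) := fun t ht => (hpd t ht).continuousAt.continuousWithinAt
  -- The primitive `(e - t) P c²` vanishes at both endpoints, and its derivative is exactly the
  -- difference of the two integrands.
  have hder : ∀ t ∈ Icc (-b) b, HasDerivAt (fun t => (e - t) * (P t * c t ^ 2))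
      ((e - t) * (G t * c t ^ 2 + P t * (2 * c t * c' t)) - P t * c t ^ 2) t := fun t ht => by
    have h1 : HasDerivAt (fun t => e - t) (-1) t := by
      simpa using (hasDerivAt_id t).const_sub e
    exact (h1.mul ((hpd t ht).mul ((hcd t).pow 2))).congr_deriv (by
      simp only [Pi.mul_apply, Pi.pow_apply]
      norm_num
      ring)
  -- Measurability on a single line does not follow from measurability almost everywhere on the
  -- cube; here it holds because `deriv` of any real function is measurable.
  have hGm : AEStronglyMeasurable G (volume.restrict (Ioo (-b) b)) := by
    refine ((measurable_deriv (Icc (-b) b |>.indicator P)).aestronglyMeasurable).congr ?_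
    filter_upwards [ae_restrict_mem measurableSet_Ioo] with t ht
    have : HasDerivAt (Icc (-b) b |>.indicator P) (G t) t := by
      refine (hpd t (Ioo_subset_Icc_self ht)).congr_of_eventuallyEq ?_
      filter_upwards [isOpen_Ioo.mem_nhds ht] with r hr
      exact indicator_of_mem (Ioo_subset_Icc_self hr) P
    exact this.deriv
  have hI1 : IntegrableOn (fun t => (e - t) * (G t * c t ^ 2 + P t * (2 * c t * c' t)))
      (Ioo (-b) b) := by
    refine Integrable.of_bound ?_ ((|e| + b) * (D + C * (2 * 1 * (Real.pi / (2 * b))))) ?_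
    · have hPm : AEStronglyMeasurable P (volume.restrict (Ioo (-b) b)) :=
        (hPc.mono Ioo_subset_Icc_self).aestronglyMeasurable measurableSet_Ioo
      have e1 : Continuous fun t : ℝ => e - t := by fun_prop
      have e2 : Continuous fun t : ℝ => 2 * c t * c' t := by fun_prop
      exact e1.aestronglyMeasurable.mul ((hGm.mul (hcc.pow 2).aestronglyMeasurable).add
        (hPm.mul e2.aestronglyMeasurable))
    · filter_upwards [ae_restrict_mem measurableSet_Ioo] with t ht
      simpa using bound2 (Function.update θ i t) (hmem t (Ioo_subset_Icc_self ht))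
  have hI2 : IntegrableOn (fun t => P t * c t ^ 2) (Ioo (-b) b) :=
    ((hPc.mul (hcc.pow 2).continuousOn).integrableOn_Icc).mono_set Ioo_subset_Icc_self
  have hFTC := intervalIntegral.integral_eq_sub_of_hasDerivAt (a := -b) (b := b)
    (f := fun t => (e - t) * (P t * c t ^ 2))
    (fun t ht => hder t (by rwa [uIcc_of_le (by linarith)] at ht))
    ((intervalIntegrable_iff_integrableOn_Ioo_of_le (by linarith)).2 (hI1.sub hI2))
  rw [intervalIntegral.integral_of_le (by linarith), integral_Ioc_eq_integral_Ioo] at hFTC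
  have hz1 : c b = 0 := cosProd_update_endpoint hb i θ (Or.inl rfl)
  have hz2 : c (-b) = 0 := cosProd_update_endpoint hb i θ (Or.inr rfl)
  rw [integral_sub hI1 hI2, hz1, hz2] at hFTC
  simp only [Function.update_self]
  linarith

end Partial

end VanTrees

end QuantizedEstimation

namespace QuantizedEstimation

open Set Filter Topology

/-! ### The multivariate van Trees inequality. -/

section VanTrees

variable {d : ℕ} {b : ℝ}

/-- The pointwise inequality behind the van Trees inequality. -/
lemma sum_cross_le {Y : Type*} [Fintype Y] {p : Y → ℝ} {s a : Y → Fin d → ℝ} {m D R κ : ℝ}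
    {m' : Fin d → ℝ} (hp : ∀ y, 0 ≤ p y) (hp1 : ∑ y, p y = 1)
    (hs : ∀ l, ∑ y, p y * s y l = 0) (hD : ∑ y, p y * ∑ l, s y l ^ 2 ≤ D)
    (hR : ∑ y, p y * ∑ l, a y l ^ 2 ≤ R) (hκ : 0 < κ) :
    ∑ l, ∑ y, a y l * (p y * s y l * m ^ 2 + p y * (2 * m * m' l)) ≤
      κ / 2 * R * m ^ 2 + (D * m ^ 2 + 4 * ∑ l, m' l ^ 2) / (2 * κ) := by
  have h1 : ∀ l y, a y l * (p y * s y l * m ^ 2 + p y * (2 * m * m' l)) ≤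
      κ / 2 * m ^ 2 * (p y * a y l ^ 2) + (1 / (2 * κ)) * (m ^ 2 * (p y * s y l ^ 2) +
        4 * m * m' l * (p y * s y l) + 4 * m' l ^ 2 * p y) := by
    intro l y
    -- Young's inequality with parameter `κ` between the error `m a` and the joint score `s m + 2
    -- m'`. On summation over `y` the mixed term drops out, since the score has mean zero.
    have h2 : 0 ≤ p y / (2 * κ) * (κ * (m * a y l) - (s y l * m + 2 * m' l)) ^ 2 :=
      mul_nonneg (div_nonneg (hp y) (by positivity)) (sq_nonneg _)
    have h3 : κ / 2 * m ^ 2 * (p y * a y l ^ 2) + (1 / (2 * κ)) * (m ^ 2 * (p y * s y l ^ 2) +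
        4 * m * m' l * (p y * s y l) + 4 * m' l ^ 2 * p y) -
        a y l * (p y * s y l * m ^ 2 + p y * (2 * m * m' l)) =
        p y / (2 * κ) * (κ * (m * a y l) - (s y l * m + 2 * m' l)) ^ 2 := by
      field_simp
      ring
    linarith
  refine (Finset.sum_le_sum fun l _ => Finset.sum_le_sum fun y _ => h1 l y).trans ?_
  have hA : ∑ l, ∑ y, p y * a y l ^ 2 = ∑ y, p y * ∑ l, a y l ^ 2 := by
    rw [Finset.sum_comm]
    simp only [Finset.mul_sum]
  have hS : ∑ l, ∑ y, p y * s y l ^ 2 = ∑ y, p y * ∑ l, s y l ^ 2 := by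
    rw [Finset.sum_comm]
    simp only [Finset.mul_sum]
  have e : ∑ l, ∑ y, (κ / 2 * m ^ 2 * (p y * a y l ^ 2) + (1 / (2 * κ)) *
      (m ^ 2 * (p y * s y l ^ 2) + 4 * m * m' l * (p y * s y l) + 4 * m' l ^ 2 * p y)) =
      κ / 2 * m ^ 2 * (∑ y, p y * ∑ l, a y l ^ 2) + (1 / (2 * κ)) *
        (m ^ 2 * (∑ y, p y * ∑ l, s y l ^ 2) + 4 * ∑ l, m' l ^ 2) := by
    simp only [Finset.sum_add_distrib, ← Finset.mul_sum, hs, hp1, hA, hS]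
    simp [Finset.mul_sum]
  rw [e]
  have h4 : κ / 2 * m ^ 2 * (∑ y, p y * ∑ l, a y l ^ 2) ≤ κ / 2 * m ^ 2 * R :=
    mul_le_mul_of_nonneg_left hR (by positivity)
  have h5 : (1 / (2 * κ)) * (m ^ 2 * (∑ y, p y * ∑ l, s y l ^ 2) + 4 * ∑ l, m' l ^ 2) ≤
      (1 / (2 * κ)) * (m ^ 2 * D + 4 * ∑ l, m' l ^ 2) := by gcongr
  calc _ ≤ κ / 2 * m ^ 2 * R + (1 / (2 * κ)) * (m ^ 2 * D + 4 * ∑ l, m' l ^ 2) := add_le_add h4 h5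
    _ = _ := by ring

/-- The multivariate van Trees inequality for a finite observation space and the cosine-squared
prior on the cube. -/
theorem van_trees {Y : Type*} [Fintype Y] (hb : 0 < b) (hd : 0 < d)
    {p : Y → (Fin d → ℝ) → ℝ} {s : Y → Fin d → (Fin d → ℝ) → ℝ} {a : Y → Fin d → ℝ} {D R : ℝ}
    (hD0 : 0 ≤ D)
    (hp : ∀ θ : Fin d → ℝ, (∀ j, θ j ∈ Icc (-b) b) → ∀ y, 0 ≤ p y θ)
    (hp1 : ∀ θ : Fin d → ℝ, (∀ j, θ j ∈ Icc (-b) b) → ∑ y, p y θ = 1)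
    (hs : ∀ θ : Fin d → ℝ, (∀ j, θ j ∈ Icc (-b) b) → ∀ l, ∑ y, p y θ * s y l θ = 0)
    (hder : ∀ θ : Fin d → ℝ, (∀ j, θ j ∈ Icc (-b) b) → ∀ y l,
      HasDerivAt (fun t => p y (Function.update θ l t)) (p y θ * s y l θ) (θ l))
    (hD : ∀ θ : Fin d → ℝ, (∀ j, θ j ∈ Icc (-b) b) → ∑ y, p y θ * ∑ l, s y l θ ^ 2 ≤ D)
    (hR : ∀ θ : Fin d → ℝ, (∀ j, θ j ∈ Icc (-b) b) →
      ∑ y, p y θ * ∑ l, (a y l - θ l) ^ 2 ≤ R) :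
    (d : ℝ) ^ 2 ≤ R * (D + d * Real.pi ^ 2 / b ^ 2) := by
  have hple : ∀ θ : Fin d → ℝ, (∀ j, θ j ∈ Icc (-b) b) → ∀ y, p y θ ≤ 1 := fun θ hθ y => by
    rw [← hp1 θ hθ]
    exact Finset.single_le_sum (f := fun y => p y θ) (fun y _ => hp θ hθ y) (Finset.mem_univ y)
  have hpC : ∀ y, ∀ θ : Fin d → ℝ, (∀ j, θ j ∈ Icc (-b) b) → |p y θ| ≤ 1 := fun y θ hθ => by
    rw [abs_of_nonneg (hp θ hθ y)]
    exact hple θ hθ y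
  have hgD : ∀ y l, ∀ θ : Fin d → ℝ, (∀ j, θ j ∈ Icc (-b) b) → |p y θ * s y l θ| ≤ √D := by
    intro y l θ hθ
    refine Real.abs_le_sqrt ?_
    have h1 : p y θ * s y l θ ^ 2 ≤ D := by
      refine le_trans ?_ (hD θ hθ)
      refine le_trans ?_ (Finset.single_le_sum (f := fun y => p y θ * ∑ l, s y l θ ^ 2)
        (fun y _ => mul_nonneg (hp θ hθ y) (Finset.sum_nonneg fun l _ => sq_nonneg _))
        (Finset.mem_univ y))
      exact mul_le_mul_of_nonneg_left (Finset.single_le_sum (f := fun l => s y l θ ^ 2)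
        (fun l _ => sq_nonneg _) (Finset.mem_univ l)) (hp θ hθ y)
    calc (p y θ * s y l θ) ^ 2 = p y θ * (p y θ * s y l θ ^ 2) := by ring
      _ ≤ p y θ * s y l θ ^ 2 := mul_le_of_le_one_left
          (mul_nonneg (hp θ hθ y) (sq_nonneg _)) (hple θ hθ y)
      _ ≤ D := h1
  have hcont : ∀ y, ∀ θ : Fin d → ℝ, (∀ j, θ j ∈ Icc (-b) b) → ∀ i,
      ContinuousAt (fun t => p y (Function.update θ i t)) (θ i) := fun y θ hθ i =>
    (hder θ hθ y i).continuousAt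
  have hibp := fun y l => integral_by_parts_cosProd hb (i := l) (p := p y)
    (g := fun θ => p y θ * s y l θ) (hpC y) (hgD y l) (aemeasurable_cubeMeasure hb (hcont y))
    (aemeasurable_partialDeriv hb (hcont y) fun θ hθ => hder θ hθ y l)
    (fun θ hθ => hder θ hθ y l) (a y l)
  set μ := cubeMeasure d b
  have hbd : 0 < b ^ d := by positivity
  -- Each coordinate contributes `b^d`: integrate by parts for each `y`, then use that the
  -- probabilities sum to one.
  have hlhs : ∫ θ, (∑ l, ∑ y, (a y l - θ l) * (p y θ * s y l θ * cosProd b θ ^ 2 +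
      p y θ * (2 * cosProd b θ * cosProdDeriv b l θ))) ∂μ = d * b ^ d := by
    rw [integral_finsetSum _ fun l _ => integrable_finsetSum _ fun y _ => (hibp y l).1]
    have : ∀ l : Fin d, ∫ θ, (∑ y, (a y l - θ l) * (p y θ * s y l θ * cosProd b θ ^ 2 +
      p y θ * (2 * cosProd b θ * cosProdDeriv b l θ))) ∂μ = b ^ d := by
      intro l
      rw [integral_finsetSum _ fun y _ => (hibp y l).1,
        Finset.sum_congr rfl fun y _ => (hibp y l).2.2,
        ← integral_finsetSum _ fun y _ => (hibp y l).2.1, ← integral_cosProd_sq hb]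
      refine integral_congr_ae ?_
      filter_upwards [ae_mem_cube] with θ hθ
      rw [← Finset.sum_mul, hp1 θ fun j => Ioo_subset_Icc_self (hθ j), one_mul]
    simp [this]
  have hm2 : Integrable (fun θ => cosProd b θ ^ 2) μ :=
    integrable_cubeMeasure_of_bound (continuous_cosProd.pow 2).aestronglyMeasurable 1
      fun θ _ => by
        rw [abs_pow]
        exact pow_le_one₀ (abs_nonneg _) (abs_cosProd_le_one θ)
  have hm'2 : ∀ l, Integrable (fun θ => cosProdDeriv b l θ ^ 2) μ := fun l =>
    integrable_cubeMeasure_of_bound ((continuous_cosProdDeriv l).pow 2).aestronglyMeasurable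
      ((Real.pi / (2 * b)) ^ 2) fun θ _ => by
        rw [abs_pow]
        exact pow_le_pow_left₀ (abs_nonneg _) (abs_cosProdDeriv_le hb l θ) 2
  have hm'sum : Integrable (fun θ => ∑ l, cosProdDeriv b l θ ^ 2) μ :=
    integrable_finsetSum _ fun l _ => hm'2 l
  have key : ∀ κ : ℝ, 0 < κ →
      (d : ℝ) ≤ κ / 2 * R + (D + d * Real.pi ^ 2 / b ^ 2) / (2 * κ) := by
    intro κ hκ
    have hrhs : ∫ θ, (κ / 2 * R * cosProd b θ ^ 2 + (D * cosProd b θ ^ 2 +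
        4 * ∑ l, cosProdDeriv b l θ ^ 2) / (2 * κ)) ∂μ =
        (κ / 2 * R + (D + d * Real.pi ^ 2 / b ^ 2) / (2 * κ)) * b ^ d := by
      rw [integral_add (hm2.const_mul _)
        (by exact ((hm2.const_mul _).add (hm'sum.const_mul _)).div_const _), integral_div,
        integral_add (hm2.const_mul _) (hm'sum.const_mul _), integral_const_mul,
        integral_const_mul, integral_const_mul, integral_finsetSum _ fun l _ => hm'2 l]
      simp only [μ, integral_cosProd_sq hb, integral_cosProdDeriv_sq hb]
      simp only [Finset.sum_const, Finset.card_univ, Fintype.card_fin, nsmul_eq_mul]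
      field_simp
      ring
    have hle : ∫ θ, (∑ l, ∑ y, (a y l - θ l) * (p y θ * s y l θ * cosProd b θ ^ 2 +
        p y θ * (2 * cosProd b θ * cosProdDeriv b l θ))) ∂μ ≤
        ∫ θ, (κ / 2 * R * cosProd b θ ^ 2 + (D * cosProd b θ ^ 2 +
        4 * ∑ l, cosProdDeriv b l θ ^ 2) / (2 * κ)) ∂μ := by
      refine integral_mono_ae
        (integrable_finsetSum _ fun l _ => integrable_finsetSum _ fun y _ => (hibp y l).1)
        ((hm2.const_mul _).add (((hm2.const_mul _).add (hm'sum.const_mul _)).div_const _)) ?_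
      filter_upwards [ae_mem_cube] with θ hθ
      have hθ' : ∀ j, θ j ∈ Icc (-b) b := fun j => Ioo_subset_Icc_self (hθ j)
      exact sum_cross_le (p := fun y => p y θ) (s := fun y l => s y l θ)
        (a := fun y l => a y l - θ l) (m := cosProd b θ) (m' := fun l => cosProdDeriv b l θ)
        (hp θ hθ') (hp1 θ hθ') (hs θ hθ') (hD θ hθ') (hR θ hθ') hκ
    rw [hlhs, hrhs] at hle
    exact le_of_mul_le_mul_right hle hbd
  set E := D + d * Real.pi ^ 2 / b ^ 2 with hE
  have hdpos : (0 : ℝ) < d := by exact_mod_cast hd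
  have hEpos : 0 < E := by positivity
  -- The choice `κ = E / d` gives `d ≤ (R E / d + d) / 2`, hence `d² ≤ R E`, without dividing by `R`
  -- or taking a square root.
  have h := key (E / d) (by positivity)
  have h2 : E / d / 2 * R + E / (2 * (E / d)) = (R * E / d + d) / 2 := by
    field_simp
  rw [h2] at h
  have h3 : (d : ℝ) ≤ R * E / d := by linarith
  rw [le_div_iff₀ hdpos] at h3
  linarith [sq (d : ℝ)]

end VanTrees

/-! ### From node information to the minimax bound. -/

section Main

variable {X : Type*} [MeasurableSpace X] {d n k : ℕ} {ν : Measure X} {Θ : Set (Param d)}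
  {f : Param d → X → ℝ} {B : ℝ} {c : Protocol X n k} {w : c.Transcript → Fin n → X → ℝ}

lemma toLp_update_eq_coordLine (θ : Fin d → ℝ) (l : Fin d) (t : ℝ) :
    (WithLp.toLp 2 (Function.update θ l t) : Param d) =
      coordLine (WithLp.toLp 2 θ) l (t - θ l) := by
  ext j
  rw [coordLine_apply]
  by_cases h : j = l
  · subst h
    simp
  · simp [h]

/-- The probability of a transcript is differentiable in each coordinate of the parameter, and its
logarithmic derivative is the sum of the conditional scores of the nodes. -/
lemma hasDerivAt_transcript_prob (hf : IsRegularFamily ν Θ f)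
    (hΘ : {θ : Param d | ∀ i, θ i ∈ Icc (-B) B} ⊆ Θ) (hw : IsFactorization c w)
    {θ : Fin d → ℝ} (hθ : ∀ i, θ i ∈ Ioo (-B) B) (y : c.Transcript) (l : Fin d) :
    HasDerivAt (fun t => ∏ i, ∫ x, w y i x ∂(dist ν f (WithLp.toLp 2 (Function.update θ l t))))
      ((∏ i, ∫ x, w y i x ∂(dist ν f (WithLp.toLp 2 θ))) *
        ∑ i, condScore (dist ν f (WithLp.toLp 2 θ)) (score Θ f (WithLp.toLp 2 θ)) (w y i) l)
      (θ l) := by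
  have hθ' : (WithLp.toLp 2 θ : Param d) ∈ openCube d B := hθ
  have := hf.isProbabilityMeasure _ (openCube_subset hΘ hθ')
  have h1 : ∀ i, HasDerivAt
      (fun t => ∫ x, w y i x ∂(dist ν f (WithLp.toLp 2 (Function.update θ l t))))
      (∫ x, w y i x * score Θ f (WithLp.toLp 2 θ) x l ∂(dist ν f (WithLp.toLp 2 θ))) (θ l) := by
    intro i
    simp only [toLp_update_eq_coordLine]
    have h := hasDerivAt_integral_dist hf hΘ hθ' l (hw.measurable y i) (hw.nonneg y i)
      (hw.le_one y i)
    rw [← sub_self (θ l)] at h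
    exact h.comp_sub_const (θ l) (θ l)
  have h2 := HasDerivAt.fun_finsetProd (u := Finset.univ) fun i _ => h1 i
  refine h2.congr_deriv ?_
  rw [Finset.mul_sum]
  refine Finset.sum_congr rfl fun i _ => ?_
  rw [Function.update_eq_self, smul_eq_mul,
    ← integral_mul_condScore (hw.measurable y i) (hw.nonneg y i) (hw.le_one y i),
    ← Finset.mul_prod_erase _ _ (Finset.mem_univ i)]
  ring

/-- A lower bound on the minimax risk from a bound on the information that each node contributes
to the transcript. -/
theorem le_iSup_risk_of_node_information (hf : IsRegularFamily ν Θ f) (hB : 0 < B)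
    (hΘ : {θ : Param d | ∀ i, θ i ∈ Icc (-B) B} ⊆ Θ) (hw : IsFactorization c w)
    (est : c.Transcript → Param d) {D : ℝ} (hD0 : 0 ≤ D)
    (hD : ∀ θ ∈ openCube d B, ∀ i, ∑ y, (∏ m, ∫ x, w y m x ∂(dist ν f θ)) *
      ∑ l, condScore (dist ν f θ) (score Θ f θ) (w y i) l ^ 2 ≤ D) :
    ENNReal.ofReal ((d : ℝ) ^ 2 / (D * n + d * Real.pi ^ 2 / B ^ 2)) ≤
      ⨆ θ ∈ Θ, ENNReal.ofReal (risk ν f c est θ) := by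
  rcases Nat.eq_zero_or_pos d with hd | hd
  · subst hd
    simp
  by_cases htop : (⨆ θ ∈ Θ, ENNReal.ofReal (risk ν f c est θ)) = ∞
  · rw [htop]
    exact le_top
  set R := (⨆ θ ∈ Θ, ENNReal.ofReal (risk ν f c est θ)).toReal with hRdef
  have hR : ∀ θ ∈ Θ, risk ν f c est θ ≤ R := fun θ hθ =>
    (ENNReal.ofReal_le_iff_le_toReal htop).1
      (le_iSup₂ (f := fun θ (_ : θ ∈ Θ) => ENNReal.ofReal (risk ν f c est θ)) θ hθ)
  -- `van_trees` asks for two-sided derivatives on a closed cube, whereas the model is regular only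
  -- along lines in the open cube of side `2B`; hence `b < B` and a limit afterwards.
  have key : ∀ b, 0 < b → b < B → (d : ℝ) ^ 2 ≤ R * (D * n + d * Real.pi ^ 2 / b ^ 2) := by
    intro b hb hbB
    have hcube : ∀ θ : Fin d → ℝ, (∀ j, θ j ∈ Icc (-b) b) →
        (WithLp.toLp 2 θ : Param d) ∈ openCube d B := fun θ hθ j =>
      ⟨by linarith [(hθ j).1], (hθ j).2.trans_lt hbB⟩
    have hprob : ∀ θ : Fin d → ℝ, (∀ j, θ j ∈ Icc (-b) b) →
        IsProbabilityMeasure (dist ν f (WithLp.toLp 2 θ)) := fun θ hθ =>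
      hf.isProbabilityMeasure _ (openCube_subset hΘ (hcube θ hθ))
    refine van_trees (Y := c.Transcript) hb hd
      (p := fun y θ => ∏ i, ∫ x, w y i x ∂(dist ν f (WithLp.toLp 2 θ)))
      (s := fun y l θ => ∑ i, condScore (dist ν f (WithLp.toLp 2 θ))
        (score Θ f (WithLp.toLp 2 θ)) (w y i) l)
      (a := fun y l => est y l) (by positivity) ?_ ?_ ?_ ?_ ?_ ?_
    · exact fun θ hθ y => hw.prod_nonneg y
    · intro θ hθ
      have := hprob θ hθ
      exact hw.sum_prob
    · intro θ hθ l
      -- The mean of the transcript score is the derivative of the total probability, which is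
      -- constantly one near `θ l`.
      have h1 := HasDerivAt.fun_sum (u := Finset.univ) fun y _ =>
        hasDerivAt_transcript_prob hf hΘ hw (hcube θ hθ) y l
      refine h1.unique ((hasDerivAt_const (θ l) (1 : ℝ)).congr_of_eventuallyEq ?_)
      filter_upwards [isOpen_Ioo.mem_nhds (hcube θ hθ l)] with t ht
      have := hf.isProbabilityMeasure (WithLp.toLp 2 (Function.update θ l t))
        (openCube_subset hΘ fun j => by
          by_cases h : j = l
          · subst h
            simpa using ht
          · simpa [h] using hcube θ hθ j)
      exact hw.sum_prob
    · exact fun θ hθ y l => hasDerivAt_transcript_prob hf hΘ hw (hcube θ hθ) y l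
    · intro θ hθ
      have := hprob θ hθ
      rw [hw.sum_sq_sum_condScore_eq
        (fun l => (memLp_score hf hΘ (hcube θ hθ) l).integrable one_le_two)
        (integral_score hf hΘ (hcube θ hθ))]
      refine (Finset.sum_le_sum fun i _ => hD _ (hcube θ hθ) i).trans (le_of_eq ?_)
      simp [mul_comm]
    · intro θ hθ
      have := hprob θ hθ
      refine le_trans (le_of_eq ?_) (hR _ (openCube_subset hΘ (hcube θ hθ)))
      unfold risk
      refine Finset.sum_congr rfl fun y _ => ?_
      rw [hw.prob_eq, EuclideanSpace.real_norm_sq_eq]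
      simp
  have hlim : (d : ℝ) ^ 2 ≤ R * (D * n + d * Real.pi ^ 2 / B ^ 2) := by
    have ht : Tendsto (fun b : ℝ => R * (D * n + d * Real.pi ^ 2 / b ^ 2)) (𝓝[<] B)
        (𝓝 (R * (D * n + d * Real.pi ^ 2 / B ^ 2))) := by
      refine Tendsto.mono_left ?_ nhdsWithin_le_nhds
      exact ((tendsto_const_nhds.div (tendsto_id.pow 2) (by positivity)).const_add _).const_mul R
    refine ge_of_tendsto ht ?_
    filter_upwards [Ioo_mem_nhdsLT hB] with b hb using key b hb.1 hb.2
  have hdpos : (0 : ℝ) < d := by exact_mod_cast hd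
  rw [← ENNReal.ofReal_toReal htop]
  refine ENNReal.ofReal_le_ofReal ?_
  rw [div_le_iff₀ (by positivity)]
  exact hlim

end Main

end QuantizedEstimation

theorem theorem3 {X : Type*} [MeasurableSpace X] {d n k : ℕ}
    (ν : Measure X) (Θ : Set (QuantizedEstimation.Param d))
    (f : QuantizedEstimation.Param d → X → ℝ)
    (hf : QuantizedEstimation.IsRegularFamily ν Θ f)
    (B I₀ : ℝ) (hB : 0 < B) (hI₀ : 0 ≤ I₀)
    (hΘ : {θ : QuantizedEstimation.Param d | ∀ i, θ i ∈ Set.Icc (-B) B} ⊆ Θ)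
    (c : QuantizedEstimation.Protocol X n k)
    (est : c.Transcript → QuantizedEstimation.Param d) :
    ((∀ θ ∈ Θ, ∀ u : QuantizedEstimation.Param d, ‖u‖ = 1 →
        variance (fun x => inner ℝ u (QuantizedEstimation.score Θ f θ x))
          (QuantizedEstimation.dist ν f θ) ≤ I₀) →
      ENNReal.ofReal ((d : ℝ) ^ 2 / (I₀ * 2 ^ k * n + d * Real.pi ^ 2 / B ^ 2)) ≤
        ⨆ θ ∈ Θ, ENNReal.ofReal (QuantizedEstimation.risk ν f c est θ)) ∧
    (∀ p : ℝ, 1 ≤ p →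
      (∀ θ ∈ Θ, ∀ u : QuantizedEstimation.Param d, ‖u‖ = 1 →
        QuantizedEstimation.orliczNorm p
          (fun x => inner ℝ u (QuantizedEstimation.score Θ f θ x))
          (QuantizedEstimation.dist ν f θ) ^ 2 ≤ ENNReal.ofReal I₀) →
      ENNReal.ofReal
          ((d : ℝ) ^ 2 / (4 * I₀ * (k : ℝ) ^ (2 / p) * n + d * Real.pi ^ 2 / B ^ 2)) ≤
        ⨆ θ ∈ Θ, ENNReal.ofReal (QuantizedEstimation.risk ν f c est θ)) := by
  obtain ⟨w, hw⟩ := c.exists_isFactorization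
  refine ⟨fun hvar => ?_, fun p hp horl => ?_⟩
  · refine QuantizedEstimation.le_iSup_risk_of_node_information hf hB hΘ hw est (by positivity)
      fun θ hθ i => ?_
    have hθΘ := QuantizedEstimation.openCube_subset hΘ hθ
    have := hf.isProbabilityMeasure θ hθΘ
    exact hw.node_information_le_of_variance (QuantizedEstimation.memLp_score hf hΘ hθ)
      (QuantizedEstimation.integral_score hf hΘ hθ) hI₀ (hvar θ hθΘ) i
  · refine QuantizedEstimation.le_iSup_risk_of_node_information hf hB hΘ hw est (by positivity)
      fun θ hθ i => ?_
    have hθΘ := QuantizedEstimation.openCube_subset hΘ hθ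
    have := hf.isProbabilityMeasure θ hθΘ
    exact hw.node_information_le_of_orliczNorm (QuantizedEstimation.memLp_score hf hΘ hθ)
      (QuantizedEstimation.integral_score hf hΘ hθ) hI₀ hp (horl θ hθΘ) i
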